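/- For $u,v\in\mathbb{R}^m$ let $\langle u,v\rangle_s=-\sum_{i\le s}u_iv_i+\sum_{i>s}u_iv_i$, and write $\mathbb{R}^m_s$ for $\mathbb{R}^m$ with this form. Let $S^m_s=\{x\in\mathbb{R}^{m+1}_s:\langle x,x\rangle_s=1\}$ and $H^m_s=\{x\in\mathbb{R}^{m+1}_{s+1}:\langle x,x\rangle_{s+1}=-1\}$ (for $S^m_m$ only the component $x_{m+1}>0$, for $H^m_0$ only the component $x_1>0$). These are the pseudo-Riemannian space forms of index $s$ and constant curvature $\kappa=0,1,-1$ respectively. Let $M$ be a connected $n$-dimensional smooth manifold, smoothly immersed as a non-degenerate hypersurface, with a smooth unit normal vector field $\xi$ ($\langle\xi,\xi\rangle=\pm1$), in an $(n+1)$-dimensional pseudo-Riemannian space form with Levi-Civita connection $\bar\nabla$. Its shape operator is $AX=-\bar\nabla_X\xi$. $M$ is called isoparametric if its principal curvatures, that is, the complex eigenvalues of $A_x$ counted with algebraic multiplicity, do not depend on $x\in M$. It is of Petrov type IV of index $1$ if for every $x\in M$ there is a basis of $T_xM$ with respect to which, for some real numbers $\alpha,\beta,a_1,\dots,a_{n-2}$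 with $\beta>0$, $$A_x\sim\begin{pmatrix}\alpha&-\beta\\ \beta&\alpha\end{pmatrix}\oplus\operatorname{diag}(a_1,\dots,a_{n-2}),\qquad \langle\cdot,\cdot\rangle_x\sim\operatorname{diag}(-1,1,1,\dots,1).$$ Theorem. There is no isoparametric hypersurface of Petrov type IV of index $1$ in $\mathbb{R}^{n+1}_1$, in $\mathbb{R}^{n+1}_2$, in $S^{n+1}_1$, or in $H^{n+1}_2$. -/

import Mathlib

open scoped ContDiff Manifold

noncomputable section

/-- The pseudo-inner product `⟨u, v⟩_t = ᵗu ((-E_t) ⊕ E_{m-t}) v` of `ℝ^m_t`. -/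
def pseudoInner (m t : ℕ) : LinearMap.BilinForm ℝ (Fin m → ℝ) :=
  Matrix.toBilin' (Matrix.diagonal fun i : Fin m => if (i : ℕ) < t then (-1 : ℝ) else 1)

theorem pseudoInner_symm (m t : ℕ) (u v : Fin m → ℝ) :
    pseudoInner m t u v = pseudoInner m t v u := by
  simp only [pseudoInner, Matrix.toBilin'_apply', Matrix.mulVec_diagonal, dotProduct]
  exact Finset.sum_congr rfl fun i _ => by ring

/-- The three families of pseudo-Riemannian space forms. -/
inductive SpaceForm
  /-- the pseudo-Euclidean spaces `ℝ^d_s` -/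
  | euclidean
  /-- the pseudo-spheres `S^d_s` -/
  | sphere
  /-- the pseudo-hyperbolic spaces `H^d_s` -/
  | hyperbolic

namespace SpaceForm

/-- The constant curvature `κ`. -/
def curvature : SpaceForm → ℝ
  | euclidean => 0
  | sphere => 1
  | hyperbolic => -1

/-- The dimension of the pseudo-Euclidean space in which the `d`-dimensional space form lies. -/
def ambientDim : SpaceForm → ℕ → ℕ
  | euclidean, d => d
  | sphere, d => d + 1
  | hyperbolic, d => d + 1

/-- The index of the pseudo-Euclidean space in which the space form of index `s` lies. -/
def ambientIndex : SpaceForm → ℕ → ℕ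
  | euclidean, s => s
  | sphere, s => s
  | hyperbolic, s => s + 1

/-- The vector space that contains the `d`-dimensional space form. -/
abbrev Ambient (N : SpaceForm) (d : ℕ) : Type := Fin (N.ambientDim d) → ℝ

/-- The pseudo-inner product of the vector space that contains the space form of dimension `d`
and index `s`. -/
def form (N : SpaceForm) (d s : ℕ) : LinearMap.BilinForm ℝ (N.Ambient d) :=
  pseudoInner (N.ambientDim d) (N.ambientIndex s)

/-- The `d`-dimensional space form of index `s` as a set: `ℝ^d_s`, `S^d_s` or `H^d_s`. Of the two
components of the quadric for `S^d_d`, and for `H^d_0`, only one is kept. -/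
def carrier : (N : SpaceForm) → (d s : ℕ) → Set (N.Ambient d)
  | euclidean, _, _ => Set.univ
  | sphere, d, s => {x : Fin (d + 1) → ℝ |
      pseudoInner (d + 1) s x x = 1 ∧ (s = d → 0 < x (Fin.last d))}
  | hyperbolic, d, s => {x : Fin (d + 1) → ℝ |
      pseudoInner (d + 1) (s + 1) x x = -1 ∧ (s = 0 → 0 < x 0)}

/-- The orthogonal projection of the ambient vector space onto the tangent space of the space form
at its point `p`: since `⟨p, p⟩ = κ` if `κ ≠ 0`, it is `v ↦ v - κ ⟨v, p⟩ p`, and it is the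
identity if `κ = 0`. -/
def tangentProj (N : SpaceForm) (d s : ℕ) (p : N.Ambient d) : N.Ambient d →ₗ[ℝ] N.Ambient d :=
  LinearMap.id - N.curvature • ((N.form d s).flip p).smulRight p

end SpaceForm

/-- A non-degenerate hypersurface of the space form `N^{n+1}_s(κ)`: a smooth immersion `ι` of an
`n`-dimensional manifold `M` into the space form whose induced metric is non-degenerate, together
with a smooth unit normal vector field `ξ`. The inclusion of an embedded hypersurface is
a special case. -/
structure Hypersurface (N : SpaceForm) (s n : ℕ) (M : Type*) [TopologicalSpace M]
    [ChartedSpace (EuclideanSpace ℝ (Fin n)) M] where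
  /-- the immersion -/
  ι : M → N.Ambient (n + 1)
  /-- the unit normal vector field -/
  ξ : M → N.Ambient (n + 1)
  ι_mem : ∀ x, ι x ∈ N.carrier (n + 1) s
  ι_smooth : ContMDiff (𝓡 n) 𝓘(ℝ, N.Ambient (n + 1)) ∞ ι
  ι_immersion : ∀ x, Function.Injective (mfderiv (𝓡 n) 𝓘(ℝ, N.Ambient (n + 1)) ι x)
  /-- the induced metric is non-degenerate -/
  nondegenerate : ∀ (x : M) (v : TangentSpace (𝓡 n) x),
    (∀ w : TangentSpace (𝓡 n) x,
      N.form (n + 1) s (mfderiv (𝓡 n) 𝓘(ℝ, N.Ambient (n + 1)) ι x v)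
        (mfderiv (𝓡 n) 𝓘(ℝ, N.Ambient (n + 1)) ι x w) = 0) → v = 0
  ξ_smooth : ContMDiff (𝓡 n) 𝓘(ℝ, N.Ambient (n + 1)) ∞ ξ
  /-- `ξ` is tangent to the space form (no condition if `κ = 0`) -/
  ξ_tangent : ∀ x, N.curvature * N.form (n + 1) s (ξ x) (ι x) = 0
  ξ_normal : ∀ (x : M) (v : TangentSpace (𝓡 n) x),
    N.form (n + 1) s (ξ x) (mfderiv (𝓡 n) 𝓘(ℝ, N.Ambient (n + 1)) ι x v) = 0
  ξ_unit : ∀ x, N.form (n + 1) s (ξ x) (ξ x) = 1 ∨ N.form (n + 1) s (ξ x) (ξ x) = -1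

namespace Hypersurface

variable {N : SpaceForm} {s n : ℕ} {M : Type*} [TopologicalSpace M]
  [ChartedSpace (EuclideanSpace ℝ (Fin n)) M]

instance finiteTangent (x : M) : Module.Finite ℝ (TangentSpace (𝓡 n) x) :=
  inferInstanceAs (Module.Finite ℝ (EuclideanSpace ℝ (Fin n)))

/-- The differential of the immersion at `x`. -/
def dι (f : Hypersurface N s n M) (x : M) : TangentSpace (𝓡 n) x →ₗ[ℝ] N.Ambient (n + 1) :=
  (mfderiv (𝓡 n) 𝓘(ℝ, N.Ambient (n + 1)) f.ι x).toLinearMap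

/-- The differential of `ξ` at `x`, as a map into the ambient vector space. -/
def dξ (f : Hypersurface N s n M) (x : M) : TangentSpace (𝓡 n) x →ₗ[ℝ] N.Ambient (n + 1) :=
  (mfderiv (𝓡 n) 𝓘(ℝ, N.Ambient (n + 1)) f.ξ x).toLinearMap

/-- The induced metric on `T_x M`. -/
def metric (f : Hypersurface N s n M) (x : M) :
    LinearMap.BilinForm ℝ (TangentSpace (𝓡 n) x) :=
  (N.form (n + 1) s).compl₁₂ (f.dι x) (f.dι x)

/-- `v ↦ ∇̄_v ξ` at `x`, where `∇̄` is the Levi-Civita connection of the space form, that is, the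
tangential part of the flat connection of the ambient vector space. -/
def covDerivNormal (f : Hypersurface N s n M) (x : M) :
    TangentSpace (𝓡 n) x →ₗ[ℝ] N.Ambient (n + 1) :=
  N.tangentProj (n + 1) s (f.ι x) ∘ₗ f.dξ x

theorem metric_nondegenerate (f : Hypersurface N s n M) (x : M) : (f.metric x).Nondegenerate := by
  have key : ∀ v, (∀ w, f.metric x v w = 0) → v = 0 := fun v hv => f.nondegenerate x v hv
  refine ⟨key, fun v hv => key v fun w => ?_⟩
  have h := hv w
  rwa [metric, LinearMap.compl₁₂_apply, SpaceForm.form, pseudoInner_symm] at h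

/-- The shape operator `A_x = -∇̄ξ` as an endomorphism of `T_x M`: the vector `A_x v` is the unique
one with `⟨A_x v, w⟩ = -⟨∇̄_v ξ, w⟩` for all `w ∈ T_x M`. -/
def shapeOperator (f : Hypersurface N s n M) (x : M) : Module.End ℝ (TangentSpace (𝓡 n) x) :=
  ((f.metric x).toDual (f.metric_nondegenerate x)).symm.toLinearMap ∘ₗ
    (-(N.form (n + 1) s).compl₁₂ (f.covDerivNormal x) (f.dι x))

/-- The principal curvatures at `x`: the complex eigenvalues of `A_x`, with algebraic
multiplicities. -/
def principalCurvatures (f : Hypersurface N s n M) (x : M) : Multiset ℂ :=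
  ((f.shapeOperator x).charpoly.map (algebraMap ℝ ℂ)).roots

/-- All principal curvatures are constant. -/
def IsIsoparametric (f : Hypersurface N s n M) : Prop :=
  ∀ x y : M, f.principalCurvatures x = f.principalCurvatures y

end Hypersurface

/-- The normal form of type IV of index 1 of a pair of an endomorphism `A` and a symmetric bilinear
form `B`: for some `α`, `β`, `a_1, …, a_k` with `β > 0` there is a basis in which the matrix of `A`
is `(α, -β; β, α) ⊕ diag(a_1, …, a_k)` and the matrix of `B` is `diag(-1, 1) ⊕ E_k`. -/
def IsTypeIVIndexOne {V : Type*} [AddCommGroup V] [Module ℝ V] (A : Module.End ℝ V)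
    (B : LinearMap.BilinForm ℝ V) : Prop :=
  ∃ (k : ℕ) (e : Module.Basis (Fin 2 ⊕ Fin k) ℝ V) (α β : ℝ) (a : Fin k → ℝ), 0 < β ∧
    LinearMap.toMatrix e e A = Matrix.fromBlocks !![α, -β; β, α] 0 0 (Matrix.diagonal a) ∧
    LinearMap.BilinForm.toMatrix e B = Matrix.fromBlocks !![-1, 0; 0, 1] 0 0 1

/-- The pair of the shape operator and the induced metric is of type IV of index 1 at every
point. -/
def Hypersurface.IsPetrovTypeIVIndexOne {N : SpaceForm} {s n : ℕ} {M : Type*} [TopologicalSpace M]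
    [ChartedSpace (EuclideanSpace ℝ (Fin n)) M] (f : Hypersurface N s n M) : Prop :=
  ∀ x : M, IsTypeIVIndexOne (f.shapeOperator x) (f.metric x)

end

/-! The proof is Cartan's identity for the non-real principal curvature μ = α + iβ, followed by a
look at its imaginary part. After complexification μ is a simple eigenvalue of the shape operator,
and it is constant because it is the only principal curvature with positive imaginary part. Its
eigenvector e₁ - i e₂ is not null for the complex bilinear extension of the metric, so near a point
there is a smooth complex field X with AX = μX and ⟨X, X⟩ = 1 (`exists_eigenfield`).

The identity (`cartan_identity`) reads Σ (εμλ + κ)/(μ - λ) = 0, the sum running over the principal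
curvatures λ other than μ, with ε = ⟨ξ, ξ⟩. A complex field has no flow on M, but Lie derivatives
along it are pure algebra in the ring of smooth complex functions with its commuting partial
derivatives; hence the abstract `ParametrizedHypersurface`. The focal map μφ + ξ is constant along
X, and X is geodesic in the hypersurface, so the form Q = G(μ - A)² + X♭ ⊗ X♭ has zero Lie
derivative along X. It is non-degenerate because μ is simple. The form S = G(μ - A) has a Lie
derivative S', and S' has the Lie derivative -G(εμA + κ)(μ - A), since the ambient derivative of
dφ(X) along X is εμξ - κφ. The trace of Q⁻¹S is Σ 1/(μ - λ), which is constant for an isoparametric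
hypersurface; its second derivative along X is minus the sum in the identity.

After multiplication by ε, a real λ contributes the imaginary part -β(λ² + κε)/|μ - λ|² and the
conjugate of μ contributes -(α² + β² + κε)/(2β). If κε ≥ 0 the total is negative, a contradiction
(`typeIV_sum_ne_zero`). The inequality κε ≥ 0 is trivial in the flat cases; in the other two,
counting signs in the ambient form gives ε = κ (`sign_sphere`, `sign_hyperbolic`). -/

noncomputable section

open Matrix TopologicalSpace

/-! ### Matrix calculus and Lie derivatives over a ring with derivations -/

namespace Derivation

variable {R : Type*} [CommRing R] [Algebra ℂ R] {a b c : Type*}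

theorem matrix_map_mul [Fintype b] (d : Derivation ℂ R R) (M : Matrix a b R) (N : Matrix b c R) :
    (M * N).map d = M.map d * N + M * N.map d := by
  ext i k
  simp only [Matrix.map_apply, Matrix.mul_apply, Matrix.add_apply, map_sum, leibniz, smul_eq_mul,
    ← Finset.sum_add_distrib]
  exact Finset.sum_congr rfl fun j _ => by ring

theorem matrix_map_add (d : Derivation ℂ R R) (M N : Matrix a b R) :
    (M + N).map d = M.map d + N.map d :=
  Matrix.map_add _ (map_add d) M N

theorem matrix_map_smul (d : Derivation ℂ R R) {r : R} (hr : d r = 0) (M : Matrix a b R) :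
    (r • M).map d = r • M.map d := by
  ext i j
  simp [hr]

theorem matrix_map_zero (d : Derivation ℂ R R) : (0 : Matrix a b R).map d = 0 :=
  Matrix.map_zero _ (map_zero d)

theorem matrix_map_one [DecidableEq b] (d : Derivation ℂ R R) : (1 : Matrix b b R).map d = 0 := by
  ext i j
  by_cases h : i = j <;> simp [h]

theorem map_trace [Fintype b] (d : Derivation ℂ R R) (M : Matrix b b R) :
    d M.trace = (M.map d).trace := by
  simp [Matrix.trace]

/-- The Jacobian matrix of a column of functions. -/
def jacobian (δ : b → Derivation ℂ R R) (u : Matrix a Unit R) : Matrix a b R :=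
  Matrix.of fun i j => δ j (u i ())

theorem jacobian_add (δ : b → Derivation ℂ R R) (u v : Matrix a Unit R) :
    jacobian δ (u + v) = jacobian δ u + jacobian δ v := by
  ext i j
  simp [jacobian]

theorem jacobian_neg (δ : b → Derivation ℂ R R) (u : Matrix a Unit R) :
    jacobian δ (-u) = -jacobian δ u := by
  ext i j
  simp [jacobian]

theorem jacobian_zero (δ : b → Derivation ℂ R R) : jacobian δ (0 : Matrix a Unit R) = 0 := by
  ext i j
  simp [jacobian]

theorem jacobian_smul (δ : b → Derivation ℂ R R) {r : R} (hr : ∀ j, δ j r = 0)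
    (u : Matrix a Unit R) : jacobian δ (r • u) = r • jacobian δ u := by
  ext i j
  simp [jacobian, hr]

theorem jacobian_smul_one (δ : b → Derivation ℂ R R) {r : R} (hr : ∀ j, δ j r = 0) :
    jacobian δ (r • (1 : Matrix Unit Unit R)) = 0 := by
  ext i j
  simp [jacobian, hr]

variable [Fintype b]

/-- The derivation along the vector field with components `X`. -/
def along (δ : b → Derivation ℂ R R) (X : Matrix b Unit R) : Derivation ℂ R R :=
  ∑ j, X j () • δ j

theorem along_apply (δ : b → Derivation ℂ R R) (X : Matrix b Unit R) (r : R) :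
    along δ X r = ∑ j, X j () * δ j r := by
  rw [along, ← Derivation.coeFnAddMonoidHom_apply, map_sum, Finset.sum_apply]
  simp

theorem map_along (δ : b → Derivation ℂ R R) (X : Matrix b Unit R) (u : Matrix a Unit R) :
    u.map (along δ X) = jacobian δ u * X := by
  ext i j
  simp only [Matrix.map_apply, along_apply, Matrix.mul_apply, jacobian, Matrix.of_apply]
  exact Finset.sum_congr rfl fun k _ => mul_comm _ _

/-- This is Cartan's formula L_X(du) = d(Xu): the last term is the correction that turns the
entrywise derivative of du into its Lie derivative. -/
theorem jacobian_map_along {δ : b → Derivation ℂ R R}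
    (hδ : ∀ i j r, δ i (δ j r) = δ j (δ i r)) (X : Matrix b Unit R) (u : Matrix a Unit R) :
    (jacobian δ u).map (along δ X)
      = jacobian δ (u.map (along δ X)) - jacobian δ u * jacobian δ X := by
  ext i j
  simp only [Matrix.map_apply, along_apply, Matrix.mul_apply, jacobian, Matrix.of_apply,
    Matrix.sub_apply, map_sum, leibniz, smul_eq_mul, ← Finset.sum_sub_distrib]
  exact Finset.sum_congr rfl fun k _ => by rw [hδ k j]; ring

theorem along_eq_zero {δ : b → Derivation ℂ R R} {r : R} (hr : ∀ j, δ j r = 0)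
    (X : Matrix b Unit R) : along δ X r = 0 := by
  simp [along_apply, hr]

/-- If the Lie derivatives of the bilinear forms `Q`, `S` along a vector field with Jacobian `T`
are `0` and `S'`, then the derivative of the trace of `S` with respect to `Q` is that of `S'`. -/
theorem trace_inverse_mul [DecidableEq b] (d : Derivation ℂ R R) {Q W T S S' : Matrix b b R}
    (hW : W * Q = 1) (hQ : Q.map d = -(T.transpose * Q) - Q * T)
    (hS : S.map d = S' - T.transpose * S - S * T) : d (W * S).trace = (W * S').trace := by
  have hQW : Q * W = 1 := mul_eq_one_comm.1 hW
  have h : W.map d * Q = W * T.transpose * Q + T := by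
    have h := d.matrix_map_mul W Q
    rw [hW, d.matrix_map_one, hQ] at h
    calc W.map d * Q = -(W * (-(T.transpose * Q) - Q * T)) := eq_neg_of_add_eq_zero_left h.symm
      _ = W * T.transpose * Q + W * Q * T := by noncomm_ring
      _ = _ := by rw [hW, one_mul]
  have hW' : W.map d = W * T.transpose + T * W := by
    calc W.map d = W.map d * Q * W := by rw [mul_assoc, hQW, mul_one]
      _ = W * T.transpose * (Q * W) + T * W := by rw [h]; noncomm_ring
      _ = _ := by rw [hQW, mul_one]
  have e : (W * S).map d = T * (W * S) - W * S * T + W * S' := by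
    rw [d.matrix_map_mul, hW', hS]
    noncomm_ring
  rw [d.map_trace, e, Matrix.trace_add, Matrix.trace_sub, Matrix.trace_mul_comm T, sub_self,
    zero_add]

theorem self_add_self_eq_zero {V : Type*} [AddCommGroup V] [Module ℂ V] {v : V}
    (h : v + v = 0) : v = 0 := by
  have : (2 : ℂ) • v = 0 := by rw [two_smul, h]
  exact (smul_eq_zero.1 this).resolve_left two_ne_zero

end Derivation

/-! ### Structure equations of a hypersurface over such a ring -/

open Derivation in
/-- A hypersurface in a space form of curvature `κ`, given by functions in a ring `R` with
commuting derivations: `φ` is the position vector, `ξ` the unit normal, `ε = ⟨ξ, ξ⟩`, `η` the matrix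
of the ambient form and `A` the matrix of the shape operator. -/
structure ParametrizedHypersurface {R : Type*} [CommRing R] [Algebra ℂ R] {a b : Type*}
    [Fintype a] [Fintype b] (δ : b → Derivation ℂ R R) where
  η : Matrix a a R
  φ : Matrix a Unit R
  ξ : Matrix a Unit R
  A : Matrix b b R
  κ : R
  ε : R
  comm : ∀ i j r, δ i (δ j r) = δ j (δ i r)
  η_symm : ηᵀ = η
  η_const : ∀ j, η.map (δ j) = 0
  κ_const : ∀ j, δ j κ = 0
  κ_cube : κ * κ * κ = κ
  ε_sq : ε * ε = 1
  ξ_normal : ξᵀ * η * jacobian δ φ = 0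
  ξ_unit : ξᵀ * η * ξ = ε • 1
  ξ_tangent : κ • (ξᵀ * η * φ) = 0
  φ_mem : κ • (φᵀ * η * φ) = (κ * κ) • 1
  shape : (jacobian δ φ)ᵀ * η * jacobian δ φ * A = -((jacobian δ φ)ᵀ * η * jacobian δ ξ)
  span : ∀ u : Matrix a Unit R, uᵀ * η * jacobian δ φ = 0 → uᵀ * η * ξ = 0 →
    κ • (uᵀ * η * φ) = 0 → u = 0

namespace ParametrizedHypersurface

open Derivation

variable {R : Type*} [CommRing R] [Algebra ℂ R] {a b : Type*} [Fintype a] [Fintype b]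
  {δ : b → Derivation ℂ R R} (H : ParametrizedHypersurface (a := a) δ)

/-- The Jacobian of the position vector. -/
def Φ : Matrix a b R := jacobian δ H.φ

/-- The metric. -/
def G : Matrix b b R := H.Φᵀ * H.η * H.Φ

theorem pair_comm {c d : Type*} (u : Matrix a c R) (v : Matrix a d R) :
    (uᵀ * H.η * v)ᵀ = vᵀ * H.η * u := by
  simp [Matrix.transpose_mul, H.η_symm, Matrix.mul_assoc]

theorem pair_comm_col (u v : Matrix a Unit R) : uᵀ * H.η * v = vᵀ * H.η * u := by
  rw [← H.pair_comm v u]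
  ext i j
  rfl

theorem G_symm : H.Gᵀ = H.G := H.pair_comm _ _

theorem pair_map {c d : Type*} (j : b) (u : Matrix a c R) (v : Matrix a d R) :
    (uᵀ * H.η * v).map (δ j) = (u.map (δ j))ᵀ * H.η * v + uᵀ * H.η * v.map (δ j) := by
  rw [matrix_map_mul, matrix_map_mul, H.η_const, Matrix.mul_zero, add_zero]
  rfl

theorem pair_map_along {c d : Type*} (X : Matrix b Unit R) (u : Matrix a c R)
    (v : Matrix a d R) : (uᵀ * H.η * v).map (along δ X)
      = (u.map (along δ X))ᵀ * H.η * v + uᵀ * H.η * v.map (along δ X) := by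
  have h : H.η.map (along δ X) = 0 := by
    ext i j
    exact along_eq_zero (fun k => congrFun (congrFun (H.η_const k) i) j) X
  rw [matrix_map_mul, matrix_map_mul, h, Matrix.mul_zero, add_zero]
  rfl

theorem jacobian_pair (u v : Matrix a Unit R) :
    jacobian δ (uᵀ * H.η * v) = vᵀ * H.η * jacobian δ u + uᵀ * H.η * jacobian δ v := by
  ext i j
  have h := congrFun (congrFun (H.pair_map j u v) ()) ()
  rw [H.pair_comm_col (u.map (δ j)) v] at h
  exact h

/-- Differentiating ε² = 1 gives 2ε dε = 0, and ε is its own inverse. -/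
theorem ε_const (j : b) : δ j H.ε = 0 := by
  have h : δ j (H.ε * H.ε) = 0 := by rw [H.ε_sq, Derivation.map_one_eq_zero]
  rw [leibniz, smul_eq_mul] at h
  have h := self_add_self_eq_zero h
  calc δ j H.ε = H.ε * (H.ε * δ j H.ε) := by rw [← mul_assoc, H.ε_sq, one_mul]
    _ = 0 := by rw [h, mul_zero]

theorem ξ_jacobian_ξ : H.ξᵀ * H.η * jacobian δ H.ξ = 0 := by
  have h := H.jacobian_pair H.ξ H.ξ
  rw [H.ξ_unit, jacobian_smul_one δ H.ε_const] at h
  exact self_add_self_eq_zero h.symm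

theorem φ_Φ : H.κ • (H.φᵀ * H.η * H.Φ) = 0 := by
  have h := jacobian_smul δ H.κ_const (H.φᵀ * H.η * H.φ)
  rw [H.φ_mem, jacobian_smul_one δ (fun j => by simp [H.κ_const]), H.jacobian_pair, smul_add] at h
  exact self_add_self_eq_zero h.symm

theorem φ_jacobian_ξ : H.κ • (H.φᵀ * H.η * jacobian δ H.ξ) = 0 := by
  have h := jacobian_smul δ H.κ_const (H.ξᵀ * H.η * H.φ)
  rw [H.ξ_tangent, jacobian_zero, H.jacobian_pair, H.ξ_normal, add_zero] at h
  exact h.symm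

theorem pair_col {c d : Type*} {v : Matrix a c R} {w : Matrix a d R}
    (h : vᵀ * H.η * w = 0) (j : d) :
    (Matrix.of fun i (_ : Unit) => w i j)ᵀ * H.η * v = 0 := by
  rw [← H.pair_comm]
  ext i k
  exact congrFun (congrFun h k) j

/-- The Weingarten formula. -/
theorem jacobian_ξ : jacobian δ H.ξ = -(H.Φ * H.A) := by
  -- The field `span` speaks of a single column, so each column of dξ + ΦA is tested against the
  -- tangent vectors, ξ and φ.
  have key : ∀ j, (Matrix.of fun i (_ : Unit) => (jacobian δ H.ξ + H.Φ * H.A) i j) = 0 := by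
    intro j
    refine H.span _ (H.pair_col ?_ j) (H.pair_col ?_ j) ?_
    · have h := H.shape
      rw [Matrix.mul_add, Φ, ← Matrix.mul_assoc, h, add_neg_cancel]
    · rw [Matrix.mul_add, ξ_jacobian_ξ, Φ, ← Matrix.mul_assoc, ξ_normal, Matrix.zero_mul, zero_add]
    · have h := H.pair_col (v := H.κ • H.φ) (w := jacobian δ H.ξ + H.Φ * H.A) (by
        rw [Matrix.transpose_smul, Matrix.smul_mul, Matrix.smul_mul, Matrix.mul_add, smul_add,
          φ_jacobian_ξ, ← Matrix.mul_assoc, ← Matrix.smul_mul, φ_Φ, Matrix.zero_mul, zero_add]) j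
      rwa [Matrix.mul_smul] at h
  refine eq_neg_of_add_eq_zero_left ?_
  ext i j
  exact congrFun (congrFun (key j) i) ()

/-- The shape operator is self-adjoint. -/
theorem G_mul_A_symm : (H.G * H.A)ᵀ = H.G * H.A := by
  have h : H.G * H.A = -(H.Φᵀ * H.η * jacobian δ H.ξ) := H.shape
  rw [h, Matrix.transpose_neg, H.pair_comm]
  congr 1
  -- Differentiating ⟨ξ, ∂_jφ⟩ = 0 turns the second fundamental form into -⟨ξ, ∂_i∂_jφ⟩, which is
  -- symmetric because the derivations commute.
  have key : ∀ i j, (H.ξ.map (δ i))ᵀ * H.η * H.φ.map (δ j)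
      = -(H.ξᵀ * H.η * (H.φ.map (δ j)).map (δ i)) := by
    intro i j
    refine eq_neg_of_add_eq_zero_left ?_
    rw [← H.pair_map]
    have h0 : H.ξᵀ * H.η * H.φ.map (δ j) = 0 := by
      ext p q
      exact congrFun (congrFun H.ξ_normal ()) j
    rw [h0]
    ext p q
    exact map_zero (δ i)
  have hc : ∀ i j, (H.φ.map (δ j)).map (δ i) = (H.φ.map (δ i)).map (δ j) := by
    intro i j
    ext p q
    exact H.comm _ _ _
  ext i j
  have h1 : ((H.ξ.map (δ i))ᵀ * H.η * H.φ.map (δ j)) () ()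
      = ((H.φ.map (δ i))ᵀ * H.η * H.ξ.map (δ j)) () () := by
    rw [H.pair_comm_col (H.φ.map (δ i)), key, key, hc]
  exact h1

end ParametrizedHypersurface

/-! ### Cartan's identity along a unit eigenvector field -/

namespace ParametrizedHypersurface

open Derivation

variable {R : Type*} [CommRing R] [Algebra ℂ R] {a b : Type*} [Fintype a] [Fintype b]
  [DecidableEq b] {δ : b → Derivation ℂ R R} (H : ParametrizedHypersurface (a := a) δ)

/-- `μ - A`. -/
def shifted (μ : R) : Matrix b b R := μ • 1 - H.A

/-- The square of `μ - A` plus the projection onto the eigenvector `X`, as a bilinear form. -/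
def focalForm (μ : R) (X : Matrix b Unit R) : Matrix b b R :=
  H.G * (H.shifted μ * H.shifted μ + X * (Xᵀ * H.G))

variable {μ : R} {X : Matrix b Unit R}

/-- The Weingarten formula applied to the focal map μφ + ξ, which stands for the focal point φ +
μ⁻¹ξ rescaled so that μ need not be invertible. -/
theorem jacobian_focal (hμ : ∀ j, δ j μ = 0) :
    jacobian δ (μ • H.φ + H.ξ) = H.Φ * H.shifted μ := by
  rw [jacobian_add, jacobian_smul δ hμ, H.jacobian_ξ, shifted, Matrix.mul_sub, Matrix.mul_smul,
    Matrix.mul_one, sub_eq_add_neg, Φ]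

theorem shifted_mul_eigenvector (hX : H.A * X = μ • X) : H.shifted μ * X = 0 := by
  rw [shifted, Matrix.sub_mul, hX, Matrix.smul_mul, Matrix.one_mul, sub_self]

/-- The focal map is constant along X, so its differential has zero Lie derivative along X. -/
theorem focal_map (hμ : ∀ j, δ j μ = 0) (hX : H.A * X = μ • X) :
    (H.Φ * H.shifted μ).map (along δ X) = -(H.Φ * H.shifted μ * jacobian δ X) := by
  have h0 : (μ • H.φ + H.ξ).map (along δ X) = 0 := by
    rw [map_along, H.jacobian_focal hμ, Matrix.mul_assoc, H.shifted_mul_eigenvector hX,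
      Matrix.mul_zero]
  rw [← H.jacobian_focal hμ, jacobian_map_along H.comm, h0, jacobian_zero, zero_sub]

omit [DecidableEq b] in
theorem Φ_map : H.Φ.map (along δ X) = jacobian δ (H.Φ * X) - H.Φ * jacobian δ X := by
  rw [Φ, jacobian_map_along H.comm, map_along]

theorem G_mul_shifted_symm : (H.G * H.shifted μ)ᵀ = H.G * H.shifted μ := by
  rw [shifted, Matrix.mul_sub, Matrix.transpose_sub, H.G_mul_A_symm, Matrix.mul_smul,
    Matrix.mul_one, Matrix.transpose_smul, H.G_symm]

/-- Self-adjointness moves μ - A onto X, which it kills. -/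
theorem eigenvector_focal (hX : H.A * X = μ • X) :
    (H.Φ * X)ᵀ * H.η * (H.Φ * H.shifted μ) = 0 := by
  have h : (H.Φ * X)ᵀ * H.η * (H.Φ * H.shifted μ) = (H.G * H.shifted μ * X)ᵀ := by
    rw [Matrix.transpose_mul (H.G * H.shifted μ) X, H.G_mul_shifted_symm, G, Matrix.transpose_mul]
    simp only [Matrix.mul_assoc]
  rw [h, Matrix.mul_assoc, H.shifted_mul_eigenvector hX, Matrix.mul_zero, Matrix.transpose_zero]

omit [DecidableEq b] in
theorem eigenvector_norm (hXX : Xᵀ * H.G * X = 1) : (H.Φ * X)ᵀ * H.η * (H.Φ * X) = 1 := by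
  rw [← hXX, G, Matrix.transpose_mul]
  simp only [Matrix.mul_assoc]

/-- The integral curves of the eigenvector field are geodesics with curvature vector
`ε μ ξ - κ φ` in the ambient space. -/
theorem eigenvector_map (hX : H.A * X = μ • X) (hμ : ∀ j, δ j μ = 0) (hXX : Xᵀ * H.G * X = 1)
    {W : Matrix b b R} (hW : W * H.focalForm μ X = 1) :
    (H.Φ * X).map (along δ X) = (H.ε * μ) • H.ξ - H.κ • H.φ := by
  set Y := H.Φ * X with hY
  set ν := Y.map (along δ X) with hν
  have hYξ : H.ξᵀ * H.η * Y = 0 := by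
    rw [hY, ← Matrix.mul_assoc]
    exact (congrArg (· * X) H.ξ_normal).trans (Matrix.zero_mul X)
  have hYφ : H.κ • (H.φᵀ * H.η * Y) = 0 := by
    rw [hY, ← Matrix.mul_assoc, ← Matrix.smul_mul, H.φ_Φ, Matrix.zero_mul]
  have hξX : H.ξ.map (along δ X) = -(μ • Y) := by
    rw [map_along, H.jacobian_ξ, Matrix.neg_mul, Matrix.mul_assoc, hX, Matrix.mul_smul]
  have hφX : H.φ.map (along δ X) = Y := map_along δ X H.φ
  have hνY : νᵀ * H.η * Y = 0 := by
    have h := H.pair_map_along X Y Y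
    rw [H.eigenvector_norm hXX, matrix_map_one, H.pair_comm_col Y] at h
    exact self_add_self_eq_zero h.symm
  -- Differentiate ⟨Y, F⟩ = 0 along X, where F is the differential of the focal map. The derivative
  -- of F is again a combination of columns of F, hence orthogonal to Y.
  have hνF : νᵀ * H.η * (H.Φ * H.shifted μ) = 0 := by
    have h := H.pair_map_along X Y (H.Φ * H.shifted μ)
    rw [H.eigenvector_focal hX, H.focal_map hμ hX, Matrix.mul_neg, 
      ← Matrix.mul_assoc _ _ (jacobian δ X),
      H.eigenvector_focal hX, Matrix.zero_mul, neg_zero, add_zero, matrix_map_zero, ← hν] at h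
    exact h.symm
  -- Orthogonality to F and to Y gives orthogonality to Φ((μ - A)² + X Xᵀ G), and the second factor
  -- is invertible because W inverts the focal form. So ν has no tangential part: X is geodesic in
  -- the hypersurface.
  have hνΦ : νᵀ * H.η * H.Φ = 0 := by
    have h : νᵀ * H.η * H.Φ * (H.shifted μ * H.shifted μ + X * (Xᵀ * H.G)) = 0 := by
      rw [Matrix.mul_add, ← Matrix.mul_assoc, Matrix.mul_assoc (νᵀ * H.η), hνF, Matrix.zero_mul,
        ← Matrix.mul_assoc _ X, Matrix.mul_assoc _ H.Φ, ← hY, hνY, Matrix.zero_mul, add_zero]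
    have hinv : (H.shifted μ * H.shifted μ + X * (Xᵀ * H.G)) * (W * H.G) = 1 := by
      rw [focalForm, ← Matrix.mul_assoc] at hW
      exact mul_eq_one_comm.1 hW
    calc νᵀ * H.η * H.Φ
        = νᵀ * H.η * H.Φ * (H.shifted μ * H.shifted μ + X * (Xᵀ * H.G)) * (W * H.G) := by
          rw [Matrix.mul_assoc _ _ (W * H.G), hinv, Matrix.mul_one]
      _ = 0 := by rw [h, Matrix.zero_mul]
  have hνξ : νᵀ * H.η * H.ξ = μ • 1 := by
    have h := H.pair_map_along X H.ξ Y
    rw [hYξ, hξX, Matrix.transpose_neg, Matrix.transpose_smul, Matrix.neg_mul, Matrix.neg_mul,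
      Matrix.smul_mul, Matrix.smul_mul, H.eigenvector_norm hXX, ← hν, H.pair_comm_col H.ξ] at h
    rw [matrix_map_zero, eq_comm, neg_add_eq_zero] at h
    exact h.symm
  have hνφ : H.κ • (νᵀ * H.η * H.φ) = -(H.κ • 1) := by
    have h := congrArg (fun M : Matrix Unit Unit R => M.map (along δ X)) hYφ
    rw [matrix_map_zero, matrix_map_smul _ (along_eq_zero H.κ_const X), H.pair_map_along, hφX,
      H.eigenvector_norm hXX, ← hν, H.pair_comm_col H.φ, smul_add] at h
    exact eq_neg_of_add_eq_zero_right h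
  rw [← sub_eq_zero]
  have e : ∀ {c : Type _} (v : Matrix a c R),
      (ν - ((H.ε * μ) • H.ξ - H.κ • H.φ))ᵀ * H.η * v
        = νᵀ * H.η * v - ((H.ε * μ) • (H.ξᵀ * H.η * v) - H.κ • (H.φᵀ * H.η * v)) := by
    intro c v
    simp only [Matrix.transpose_sub, Matrix.transpose_smul, Matrix.sub_mul, Matrix.smul_mul]
  -- Both sides have the same products with the tangent vectors, with ξ and, weighted by κ, with φ.
  -- The relation κ³ = κ treats the three curvatures at once.
  refine H.span _ ?_ ?_ ?_
  · change (ν - ((H.ε * μ) • H.ξ - H.κ • H.φ))ᵀ * H.η * H.Φ = 0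
    have h1 : H.ξᵀ * H.η * H.Φ = 0 := H.ξ_normal
    rw [e, hνΦ, h1, H.φ_Φ, smul_zero, sub_zero, sub_zero]
  · simp only [Matrix.transpose_sub, Matrix.transpose_smul, Matrix.sub_mul, Matrix.smul_mul]
    rw [hνξ, H.ξ_unit, H.pair_comm_col H.φ, H.ξ_tangent, sub_zero, smul_smul,
      mul_right_comm, H.ε_sq, one_mul, sub_self]
  · simp only [Matrix.transpose_sub, Matrix.transpose_smul, Matrix.sub_mul, Matrix.smul_mul,
      smul_sub]
    rw [hνφ, smul_comm H.κ (H.ε * μ), H.ξ_tangent, H.φ_mem, smul_zero, smul_smul, ← mul_assoc,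
      H.κ_cube, zero_sub, sub_neg_eq_add, neg_add_cancel]

/-- Cartan's identity for an eigenvector field `X` of the shape operator with constant eigenvalue
`μ`: if the trace of the inverse of `μ - A` on the complement of `X` is constant, then the trace
of the composition of this inverse with `ε μ A + κ` vanishes. -/
theorem cartan_identity (hX : H.A * X = μ • X) (hμ : ∀ j, δ j μ = 0)
    (hXX : Xᵀ * H.G * X = 1) {W : Matrix b b R} (hW : W * H.focalForm μ X = 1)
    (htr : ∀ j, δ j (W * (H.G * H.shifted μ)).trace = 0) :
    (W * (H.G * (((H.ε * μ) • H.A + H.κ • 1) * H.shifted μ))).trace = 0 := by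
  set d := along δ X with hd
  set T := jacobian δ X with hT
  set B := H.shifted μ with hB
  set F := H.Φ * B with hF
  set Y := H.Φ * X with hY
  have hFd : F.map d = -(F * T) := H.focal_map hμ hX
  have hΦd : H.Φ.map d = jacobian δ Y - H.Φ * T := H.Φ_map
  have hν := H.eigenvector_map hX hμ hXX hW
  -- The 1-form X♭ = ⟨Y, dφ⟩ has zero Lie derivative along X: the derivative of Y is normal to the
  -- hypersurface, and ⟨Y, dY⟩ = 0 since Y has unit length.
  have hθ : ((Y)ᵀ * H.η * H.Φ).map d = -(Yᵀ * H.η * H.Φ * T) := by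
    have h0 : (Y.map d)ᵀ * H.η * H.Φ = 0 := by
      have h1 : H.ξᵀ * H.η * H.Φ = 0 := H.ξ_normal
      rw [hν, Matrix.transpose_sub, Matrix.transpose_smul, Matrix.transpose_smul, Matrix.sub_mul,
        Matrix.sub_mul, Matrix.smul_mul, Matrix.smul_mul, Matrix.smul_mul, Matrix.smul_mul, h1,
        H.φ_Φ, smul_zero, sub_zero]
    have h1 : Yᵀ * H.η * jacobian δ Y = 0 := by
      have h := H.jacobian_pair Y Y
      rw [H.eigenvector_norm hXX] at h
      refine self_add_self_eq_zero (h.symm.trans ?_)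
      rw [← one_smul R (1 : Matrix Unit Unit R)]
      exact jacobian_smul_one δ fun j => Derivation.map_one_eq_zero _
    rw [H.pair_map_along, h0, hΦd, Matrix.mul_sub, h1, zero_add, zero_sub, Matrix.mul_assoc _ H.Φ]
  -- The focal form is the pullback metric of the focal map plus X♭ ⊗ X♭, two terms with zero Lie
  -- derivative along X.
  have hQ' : H.focalForm μ X = Fᵀ * H.η * F + (Yᵀ * H.η * H.Φ)ᵀ * (Yᵀ * H.η * H.Φ) := by
    have h1 : Yᵀ * H.η * H.Φ = Xᵀ * H.G := by
      rw [hY, G, Matrix.transpose_mul]; simp only [Matrix.mul_assoc]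
    have h2 : Fᵀ * H.η * F = H.G * (B * B) := by
      rw [← Matrix.mul_assoc H.G, ← H.G_mul_shifted_symm, ← hB, Matrix.transpose_mul H.G, H.G_symm,
        hF, G, Matrix.transpose_mul]
      simp only [Matrix.mul_assoc]
    rw [focalForm, h1, h2, Matrix.mul_add, Matrix.transpose_mul, H.G_symm,
      Matrix.transpose_transpose]
    simp only [Matrix.mul_assoc, hB]
  have hQ : (H.focalForm μ X).map d
      = -(Tᵀ * H.focalForm μ X) - H.focalForm μ X * T := by
    have h3 : ((Yᵀ * H.η * H.Φ)ᵀ).map d = -(Tᵀ * (Yᵀ * H.η * H.Φ)ᵀ) := by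
      rw [← Matrix.transpose_mul, ← Matrix.transpose_neg, ← hθ]
      rfl
    rw [hQ', matrix_map_add, H.pair_map_along, ← hd, matrix_map_mul d (Yᵀ * H.η * H.Φ)ᵀ,
      hFd, hθ, h3]
    simp only [Matrix.transpose_neg, Matrix.transpose_mul F, Matrix.neg_mul, Matrix.mul_neg,
      Matrix.mul_add, Matrix.add_mul, Matrix.mul_assoc]
    abel
  -- Write S = ⟨dφ, F⟩. Only the first factor contributes to the Lie derivative, and that of dφ is
  -- dY.
  have hP : (H.G * B).map d
      = (jacobian δ Y)ᵀ * H.η * F - Tᵀ * (H.G * B) - H.G * B * T := by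
    have h1 : H.G * B = H.Φᵀ * H.η * F := by rw [G, hF]; simp only [Matrix.mul_assoc]
    rw [h1, H.pair_map_along, hFd, hΦd]
    simp only [Matrix.transpose_sub, Matrix.transpose_mul H.Φ T, Matrix.sub_mul, Matrix.mul_neg,
      Matrix.mul_assoc]
    abel
  -- The Lie derivative of dY is the differential of εμξ - κφ, which is -Φ(εμA + κ) by the
  -- Weingarten formula.
  have hN : ((jacobian δ Y)ᵀ * H.η * F).map d
      = -(H.G * (((H.ε * μ) • H.A + H.κ • 1) * B)) - Tᵀ * ((jacobian δ Y)ᵀ * H.η * F)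
        - (jacobian δ Y)ᵀ * H.η * F * T := by
    have hεμ : ∀ j, δ j (H.ε * μ) = 0 := fun j => by
      rw [leibniz, hμ, H.ε_const, smul_zero, smul_zero, add_zero]
    have h1 : (jacobian δ Y).map d
        = -(H.Φ * ((H.ε * μ) • H.A + H.κ • 1)) - jacobian δ Y * T := by
      rw [hd, jacobian_map_along H.comm, hν, sub_eq_add_neg (_ • H.ξ), jacobian_add, jacobian_neg,
        jacobian_smul δ hεμ, jacobian_smul δ H.κ_const, H.jacobian_ξ, Matrix.mul_add,
        Matrix.mul_smul, Matrix.mul_smul, Matrix.mul_one, smul_neg, neg_add, Φ]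
    have h2 : (H.Φ * ((H.ε * μ) • H.A + H.κ • 1))ᵀ * H.η * F
        = H.G * (((H.ε * μ) • H.A + H.κ • 1) * B) := by
      have h3 : ((H.ε * μ) • H.A + H.κ • 1)ᵀ * H.G = H.G * ((H.ε * μ) • H.A + H.κ • 1) := by
        have h4 : H.Aᵀ * H.G = H.G * H.A := by
          rw [← H.G_mul_A_symm, Matrix.transpose_mul, H.G_symm]
        rw [Matrix.transpose_add, Matrix.transpose_smul, Matrix.transpose_smul,
          Matrix.transpose_one, Matrix.add_mul, Matrix.mul_add, Matrix.smul_mul, Matrix.mul_smul,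
          h4, Matrix.smul_mul, Matrix.mul_smul, Matrix.one_mul, Matrix.mul_one]
      rw [← Matrix.mul_assoc H.G, ← h3, G, hF, Matrix.transpose_mul]
      simp only [Matrix.mul_assoc]
    rw [H.pair_map_along, hFd, ← hd, h1, Matrix.transpose_sub, Matrix.sub_mul, Matrix.sub_mul,
      Matrix.transpose_neg, Matrix.neg_mul, Matrix.neg_mul, h2, Matrix.transpose_mul _ T]
    simp only [Matrix.mul_neg, Matrix.mul_assoc]
    abel
  -- The first derivative of the constant trace is the trace for S', and the derivative of that is
  -- the trace for the second Lie derivative.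
  have t1 := trace_inverse_mul d hW hQ hP
  have t2 := trace_inverse_mul d hW hQ hN
  have z1 : d (W * (H.G * B)).trace = 0 := along_eq_zero htr X
  rw [← t1, z1, map_zero, Matrix.mul_neg, Matrix.trace_neg, eq_comm, neg_eq_zero] at t2
  exact t2

end ParametrizedHypersurface

/-! ### The ring of smooth complex functions on an open set -/

section

variable {E : Type*} [NormedAddCommGroup E] [NormedSpace ℝ E]

/-- The algebra of smooth complex functions on an open set `U` of a normed space. -/
def smoothFunctions (U : Opens E) : Subalgebra ℂ (U → ℂ) where
  carrier := {f | ∃ g : E → ℂ, ContDiffOn ℝ ∞ g U ∧ ∀ x : U, f x = g x}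
  mul_mem' := by
    rintro f f' ⟨g, hg, h⟩ ⟨g', hg', h'⟩
    exact ⟨g * g', hg.mul hg', fun x => by simp [h, h']⟩
  add_mem' := by
    rintro f f' ⟨g, hg, h⟩ ⟨g', hg', h'⟩
    exact ⟨g + g', hg.add hg', fun x => by simp [h, h']⟩
  algebraMap_mem' c := ⟨fun _ => c, contDiffOn_const, fun _ => rfl⟩

namespace smoothFunctions

variable {U : Opens E}

/-- The extension of a function on `U` by zero. -/
def ext (f : smoothFunctions U) : E → ℂ := Function.extend Subtype.val f.1 0

theorem ext_apply (f : smoothFunctions U) (x : U) : ext f x = f.1 x :=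
  Subtype.val_injective.extend_apply _ _ _

theorem contDiffOn_ext (f : smoothFunctions U) : ContDiffOn ℝ ∞ (ext f) U := by
  obtain ⟨g, hg, h⟩ := f.2
  exact hg.congr fun x hx => (ext_apply f ⟨x, hx⟩).trans (h ⟨x, hx⟩)

theorem contDiffAt_ext (f : smoothFunctions U) (x : U) : ContDiffAt ℝ ∞ (ext f) x :=
  (contDiffOn_ext f).contDiffAt (U.2.mem_nhds x.2)

theorem differentiableAt_ext (f : smoothFunctions U) (x : U) : DifferentiableAt ℝ (ext f) x :=
  (contDiffAt_ext f x).differentiableAt (by simp)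

/-- The element of the algebra defined by a function that is smooth on `U`. -/
def restrict (g : E → ℂ) (hg : ContDiffOn ℝ ∞ g U) : smoothFunctions U :=
  ⟨fun x => g x, g, hg, fun _ => rfl⟩

theorem ext_restrict (g : E → ℂ) (hg : ContDiffOn ℝ ∞ g U) (x : U) :
    ext (restrict g hg) =ᶠ[nhds (x : E)] g :=
  Filter.eventuallyEq_of_mem (U.2.mem_nhds x.2) fun y hy => ext_apply (restrict g hg) ⟨y, hy⟩

/-- The evaluation at a point. -/
def eval (x : U) : smoothFunctions U →ₐ[ℂ] ℂ :=
  (Pi.evalAlgHom ℂ (fun _ : U => ℂ) x).comp (smoothFunctions U).val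

theorem eval_restrict (g : E → ℂ) (hg : ContDiffOn ℝ ∞ g U) (x : U) :
    eval x (restrict g hg) = g x := rfl

theorem eval_ext {f g : smoothFunctions U} (h : ∀ x, eval x f = eval x g) : f = g :=
  Subtype.ext (funext h)

theorem isUnit_of_eval_ne_zero {f : smoothFunctions U} (h : ∀ x, eval x f ≠ 0) : IsUnit f := by
  refine IsUnit.of_mul_eq_one (restrict (fun x => (ext f x)⁻¹) ((contDiffOn_ext f).inv
    fun x hx => ?_)) (eval_ext fun x => ?_)
  · rw [ext_apply f ⟨x, hx⟩]
    exact h ⟨x, hx⟩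
  · rw [map_mul, map_one, eval_restrict, ext_apply]
    exact mul_inv_cancel₀ (h x)

/-- The derivative in a constant direction. -/
def pderiv (U : Opens E) (v : E) : Derivation ℂ (smoothFunctions U) (smoothFunctions U) where
  toFun f := restrict (fun x => fderiv ℝ (ext f) x v)
    (((contDiffOn_ext f).fderiv_of_isOpen U.2 (m := ∞) (by simp)).clm_apply contDiffOn_const)
  map_add' f g := by
    refine eval_ext fun x => ?_
    have h : ext (f + g) = ext f + ext g := by
      rw [ext, ext, ext, ← Function.extend_add, add_zero]
      rfl
    rw [map_add, eval_restrict, eval_restrict, eval_restrict, h,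
      fderiv_add (differentiableAt_ext f x) (differentiableAt_ext g x)]
    rfl
  map_smul' c f := by
    refine eval_ext fun x => ?_
    have h : ext (c • f) = c • ext f := by
      funext y
      by_cases hy : y ∈ U
      · exact (ext_apply (c • f) ⟨y, hy⟩).trans (by rw [Pi.smul_apply, ext_apply f ⟨y, hy⟩]; rfl)
      · have hy' : ¬ ∃ a : U, (a : E) = y := by rintro ⟨a, rfl⟩; exact hy a.2
        simp [ext, Function.extend_apply' _ _ _ hy']
    rw [eval_restrict, h, fderiv_const_smul (differentiableAt_ext f x)]
    rfl
  map_one_eq_zero' := by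
    refine eval_ext fun x => ?_
    have h : (1 : smoothFunctions U) = restrict (fun _ => 1) contDiffOn_const := rfl
    change fderiv ℝ (ext 1) (x : E) v = 0
    rw [h, (ext_restrict _ _ x).fderiv_eq]
    simp
  leibniz' f g := by
    refine eval_ext fun x => ?_
    have h : f * g = restrict (fun x => ext f x * ext g x)
        ((contDiffOn_ext f).mul (contDiffOn_ext g)) :=
      eval_ext fun x => by rw [map_mul, eval_restrict, ext_apply, ext_apply]; rfl
    change fderiv ℝ (ext (f * g)) (x : E) v
      = f.1 x * fderiv ℝ (ext g) (x : E) v + g.1 x * fderiv ℝ (ext f) (x : E) v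
    rw [h, (ext_restrict _ _ x).fderiv_eq,
      fderiv_fun_mul (differentiableAt_ext f x) (differentiableAt_ext g x), ← ext_apply,
      ← ext_apply]
    rfl

theorem eval_pderiv (v : E) (f : smoothFunctions U) (x : U) :
    eval x (pderiv U v f) = fderiv ℝ (ext f) x v := rfl

theorem eval_pderiv_restrict (v : E) (g : E → ℂ) (hg : ContDiffOn ℝ ∞ g U) (x : U) :
    eval x (pderiv U v (restrict g hg)) = fderiv ℝ g x v := by
  rw [eval_pderiv, (ext_restrict g hg x).fderiv_eq]

theorem pderiv_comm (v w : E) (f : smoothFunctions U) :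
    pderiv U v (pderiv U w f) = pderiv U w (pderiv U v f) := by
  refine eval_ext fun x => ?_
  have h : ∀ v w : E, eval x (pderiv U v (pderiv U w f)) = fderiv ℝ (fderiv ℝ (ext f)) x v w := by
    intro v w
    have hd : DifferentiableAt ℝ (fderiv ℝ (ext f)) x :=
      ((contDiffAt_ext f x).fderiv_right (m := ∞) (by simp)).differentiableAt (by simp)
    refine (eval_pderiv_restrict v _ _ x).trans ?_
    rw [fderiv_clm_apply hd (differentiableAt_const _)]
    simp
  rw [h, h]
  exact (contDiffAt_ext f x).isSymmSndFDerivAt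
    (minSmoothness_of_isRCLikeNormedField.trans_le ENat.LEInfty.out) v w

theorem pderiv_eq_zero_of_eval_eq {f : smoothFunctions U} {c : ℂ} (h : ∀ x, eval x f = c) (v : E) :
    pderiv U v f = 0 := by
  have : f = algebraMap ℂ (smoothFunctions U) c := eval_ext h
  rw [this, Derivation.map_algebraMap]

end smoothFunctions

end

/-! ### Traces in an eigenbasis, and Gram matrices -/

namespace Matrix

variable {K : Type*} [Field K] {a b c J : Type*} [Fintype a] [Fintype b] [Fintype J]
  [DecidableEq a] [DecidableEq b] [DecidableEq J]

/-- A diagonalization of the matrix `A` in which the eigenvalue at the index `o` is simple. -/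
structure SimpleDiagonalization (A : Matrix b b K) (S : Matrix b J K) (S' : Matrix J b K)
    (l : J → K) (o : J) : Prop where
  mul_inv : S * S' = 1
  inv_mul : S' * S = 1
  mul_eq : A * S = S * diagonal l
  simple : ∀ j, j ≠ o → l j ≠ l o

variable {A G : Matrix b b K} {S : Matrix b J K} {S' : Matrix J b K} {l : J → K} {o : J}

theorem trace_eq_sum_of_mul_eq {M : Matrix b b K} {m : J → K} (h : S * S' = 1) (h' : S' * S = 1)
    (hM : M * S = S * diagonal m) : M.trace = ∑ j, m j := by
  have : M = S * diagonal m * S' := by rw [← hM, Matrix.mul_assoc, h, Matrix.mul_one]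
  rw [this, Matrix.trace_mul_comm, ← Matrix.mul_assoc, h', Matrix.one_mul, trace_diagonal]

namespace SimpleDiagonalization

theorem shifted_mul (h : SimpleDiagonalization A S S' l o) :
    (l o • 1 - A) * S = S * diagonal fun j => l o - l j := by
  rw [Matrix.sub_mul, h.mul_eq, Matrix.smul_mul, Matrix.one_mul, ← diagonal_sub, Matrix.mul_sub]
  congr 1
  rw [← smul_one_eq_diagonal, Matrix.mul_smul, Matrix.mul_one]

/-- X is a right eigenvector of A and, by self-adjointness, Xᵀ G is a left one. As the eigenvalue at
o is simple, both have only the coordinate o in the eigenbasis, and ⟨X, X⟩ = 1 makes the product of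
the two coordinates 1. -/
theorem projection_mul (h : SimpleDiagonalization A S S' l o) (hG : Gᵀ = G)
    (hGA : (G * A)ᵀ = G * A) {X : Matrix b Unit K} (hX : A * X = l o • X)
    (hXX : Xᵀ * G * X = 1) : X * (Xᵀ * G) * S = S * diagonal (Pi.single o 1 : J → K) := by
  set r := Xᵀ * G * S with hr
  set c := S' * X with hc
  have hXc : X = S * c := by rw [hc, ← Matrix.mul_assoc, h.mul_inv, Matrix.one_mul]
  have hrc : r * c = 1 := by rw [hr, Matrix.mul_assoc, ← hXc, hXX]
  have hcj : ∀ j, j ≠ o → c j () = 0 := by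
    intro j hj
    have h1 : diagonal l * c = l o • c := by
      calc diagonal l * c = S' * S * (diagonal l * c) := by rw [h.inv_mul, Matrix.one_mul]
        _ = S' * (S * diagonal l * c) := by simp only [Matrix.mul_assoc]
        _ = S' * (A * X) := by rw [← h.mul_eq, Matrix.mul_assoc A, ← hXc]
        _ = l o • c := by rw [hX, Matrix.mul_smul]
    have h2 := congrFun (congrFun h1 j) ()
    rw [diagonal_mul, smul_apply, smul_eq_mul, ← sub_eq_zero, ← sub_mul] at h2
    exact (mul_eq_zero.1 h2).resolve_left (sub_ne_zero.2 (h.simple j hj))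
  have hrj : ∀ j, j ≠ o → r () j = 0 := by
    intro j hj
    have h0 : Xᵀ * G * A = l o • (Xᵀ * G) := by
      rw [Matrix.mul_assoc, ← hGA, ← Matrix.transpose_mul, Matrix.mul_assoc, hX, Matrix.mul_smul,
        Matrix.transpose_smul, Matrix.transpose_mul, hG]
    have h1 : r * diagonal l = l o • r := by
      rw [hr, Matrix.mul_assoc, ← h.mul_eq, ← Matrix.mul_assoc, h0, Matrix.smul_mul]
    have h2 := congrFun (congrFun h1 ()) j
    rw [mul_diagonal, smul_apply, smul_eq_mul, mul_comm, ← sub_eq_zero, ← sub_mul] at h2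
    exact (mul_eq_zero.1 h2).resolve_left (sub_ne_zero.2 (h.simple j hj))
  have h1 : c o () * r () o = 1 := by
    have h2 := congrFun (congrFun hrc ()) ()
    rw [Matrix.mul_apply, Finset.sum_eq_single o (fun j _ hj => by rw [hcj j hj, mul_zero])
      (by simp)] at h2
    rw [mul_comm, h2]
    rfl
  have hcr : c * r = diagonal (Pi.single o 1 : J → K) := by
    ext i j
    rw [Matrix.mul_apply, Fintype.sum_unique, diagonal_apply]
    by_cases hi : i = o
    · subst hi
      by_cases hj : j = i
      · subst hj
        simpa using h1
      · rw [if_neg (Ne.symm hj)]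
        exact (congrArg (c i () * ·) (hrj j hj)).trans (mul_zero _)
    · have h3 : c i () * r () j = 0 := by rw [hcj i hi, zero_mul]
      simpa [Pi.single_eq_of_ne hi] using h3
  rw [Matrix.mul_assoc X, ← hr, ← hcr, ← Matrix.mul_assoc S, ← hXc]

theorem focal_mul (h : SimpleDiagonalization A S S' l o) (hG : Gᵀ = G)
    (hGA : (G * A)ᵀ = G * A) {X : Matrix b Unit K} (hX : A * X = l o • X)
    (hXX : Xᵀ * G * X = 1) :
    ((l o • 1 - A) * (l o • 1 - A) + X * (Xᵀ * G)) * S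
      = S * diagonal fun j => (l o - l j) * (l o - l j) + (Pi.single o 1 : J → K) j := by
  rw [Matrix.add_mul, Matrix.mul_assoc, h.shifted_mul, ← Matrix.mul_assoc, h.shifted_mul,
    h.projection_mul hG hGA hX hXX, Matrix.mul_assoc, diagonal_mul_diagonal, ← Matrix.mul_add,
    diagonal_add]

theorem focal_ne_zero (h : SimpleDiagonalization A S S' l o) (j : J) :
    (l o - l j) * (l o - l j) + (Pi.single o 1 : J → K) j ≠ 0 := by
  by_cases hj : j = o
  · subst hj
    simp
  · have : l o - l j ≠ 0 := sub_ne_zero.2 (h.simple j hj).symm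
    simp [Pi.single_eq_of_ne hj, this]

theorem focal_det_ne_zero (h : SimpleDiagonalization A S S' l o) (hG : Gᵀ = G)
    (hGA : (G * A)ᵀ = G * A) {X : Matrix b Unit K} (hX : A * X = l o • X)
    (hXX : Xᵀ * G * X = 1) (hdet : G.det ≠ 0) :
    (G * ((l o • 1 - A) * (l o • 1 - A) + X * (Xᵀ * G))).det ≠ 0 := by
  rw [det_mul]
  refine mul_ne_zero hdet (IsUnit.ne_zero ?_)
  refine (isUnit_iff_isUnit_det _).1 (IsUnit.of_mul_eq_one (S * (diagonal fun j =>
    ((l o - l j) * (l o - l j) + (Pi.single o 1 : J → K) j)⁻¹) * S') ?_)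
  rw [← Matrix.mul_assoc, ← Matrix.mul_assoc, h.focal_mul hG hGA hX hXX, Matrix.mul_assoc S,
    diagonal_mul_diagonal]
  simp only [mul_inv_cancel₀ (h.focal_ne_zero _), diagonal_one, Matrix.mul_one, h.mul_inv]

/-- Everything is diagonal in the basis S. At o the factor μ - A contributes 0; elsewhere one factor
of (μ - λ)² cancels. This computes both traces in Cartan's identity. -/
theorem trace_focal (h : SimpleDiagonalization A S S' l o) (hG : Gᵀ = G)
    (hGA : (G * A)ᵀ = G * A) {X : Matrix b Unit K} (hX : A * X = l o • X)
    (hXX : Xᵀ * G * X = 1) {W : Matrix b b K}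
    (hW : W * (G * ((l o • 1 - A) * (l o • 1 - A) + X * (Xᵀ * G))) = 1) {M : Matrix b b K}
    {m : J → K} (hM : M * S = S * diagonal m) :
    (W * (G * (M * (l o • 1 - A)))).trace = ∑ j ∈ Finset.univ.erase o, m j / (l o - l j) := by
  have hWS : W * G * S = S * diagonal fun j =>
      ((l o - l j) * (l o - l j) + (Pi.single o 1 : J → K) j)⁻¹ := by
    have h1 : W * G * S * (diagonal fun j =>
        (l o - l j) * (l o - l j) + (Pi.single o 1 : J → K) j) = S := by
      rw [Matrix.mul_assoc, ← h.focal_mul hG hGA hX hXX, ← Matrix.mul_assoc, Matrix.mul_assoc W, hW,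
        Matrix.one_mul]
    conv_rhs => rw [← h1]
    rw [Matrix.mul_assoc _ (diagonal _), diagonal_mul_diagonal]
    simp only [mul_inv_cancel₀ (h.focal_ne_zero _), diagonal_one, Matrix.mul_one]
  have e : W * (G * (M * (l o • 1 - A))) * S = S * diagonal fun j =>
      ((l o - l j) * (l o - l j) + (Pi.single o 1 : J → K) j)⁻¹ * (m j * (l o - l j)) := by
    simp only [Matrix.mul_assoc]
    rw [h.shifted_mul, ← Matrix.mul_assoc M, hM, Matrix.mul_assoc S, diagonal_mul_diagonal,
      ← Matrix.mul_assoc, ← Matrix.mul_assoc, hWS, Matrix.mul_assoc S, diagonal_mul_diagonal]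
  rw [trace_eq_sum_of_mul_eq h.mul_inv h.inv_mul e, ← Finset.add_sum_erase _ _ (Finset.mem_univ o)]
  simp only [sub_self, mul_zero, zero_add]
  refine Finset.sum_congr rfl fun j hj => ?_
  have hj' := Finset.ne_of_mem_erase hj
  have : l o - l j ≠ 0 := sub_ne_zero.2 (h.simple j hj').symm
  rw [Pi.single_eq_of_ne hj', add_zero]
  field_simp

end SimpleDiagonalization

/-- Vectors that are orthogonal to a set of `dim` vectors with invertible Gram matrix vanish. -/
theorem eq_zero_of_isUnit_gram {η : Matrix a a K} (hη : η * η = 1) {Ψ : Matrix a J K}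
    (hcard : Fintype.card a = Fintype.card J) (hΨ : (Ψᵀ * η * Ψ).det ≠ 0) {u : Matrix a Unit K}
    (hu : uᵀ * η * Ψ = 0) : u = 0 := by
  have h1 : (Ψᵀ * η * Ψ)⁻¹ * (Ψᵀ * η) * Ψ = 1 := by
    rw [Matrix.mul_assoc]
    exact nonsing_inv_mul _ (isUnit_iff_ne_zero.2 hΨ)
  -- Since Ψ has as many columns as rows, its left inverse is also a right inverse.
  have h2 := (mul_eq_one_comm_of_card_eq _ _ _ hcard.symm).1 h1
  have h3 : uᵀ = 0 := by
    calc uᵀ = uᵀ * η * (Ψ * ((Ψᵀ * η * Ψ)⁻¹ * (Ψᵀ * η))) * η := by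
          rw [h2, Matrix.mul_one, Matrix.mul_assoc, hη, Matrix.mul_one]
      _ = 0 := by rw [← Matrix.mul_assoc, hu, Matrix.zero_mul, Matrix.zero_mul]
  exact Matrix.transpose_eq_zero.1 h3

/-- An orthonormal family has at most as many members as there are positive diagonal entries. -/
theorem card_le_of_gram_eq_one (d : a → ℝ) {v : Matrix a J ℝ}
    (hv : vᵀ * diagonal d * v = 1) : Fintype.card J ≤ Fintype.card {i // 0 < d i} := by
  -- Keep only the coordinates with positive sign. A combination w killed by this map has w · w = Σ
  -- dᵢ (vw)ᵢ² ≤ 0, so w = 0.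
  let f : (J → ℝ) →ₗ[ℝ] ({i // 0 < d i} → ℝ) := (v.submatrix Subtype.val id).mulVecLin
  have hf : Function.Injective f := by
    refine (injective_iff_map_eq_zero f).2 fun w hw => ?_
    have h1 : ∀ i, 0 < d i → (v *ᵥ w) i = 0 := fun i hi => congrFun hw ⟨i, hi⟩
    have h2 : w ⬝ᵥ w = ∑ i, d i * ((v *ᵥ w) i * (v *ᵥ w) i) := by
      calc w ⬝ᵥ w = w ⬝ᵥ ((vᵀ * diagonal d * v) *ᵥ w) := by rw [hv, one_mulVec]
        _ = (v *ᵥ w) ⬝ᵥ (diagonal d *ᵥ (v *ᵥ w)) := by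
          rw [← mulVec_mulVec, ← mulVec_mulVec, dotProduct_mulVec, vecMul_transpose]
        _ = _ := by
          simp only [dotProduct, mulVec_diagonal]
          exact Finset.sum_congr rfl fun i _ => by ring
    have h3 : w ⬝ᵥ w ≤ 0 := by
      rw [h2]
      refine Finset.sum_nonpos fun i _ => ?_
      by_cases hi : 0 < d i
      · rw [h1 i hi]; simp
      · exact mul_nonpos_of_nonpos_of_nonneg (not_lt.1 hi) (mul_self_nonneg _)
    have h4 : 0 ≤ w ⬝ᵥ w := Finset.sum_nonneg fun i _ => mul_self_nonneg _
    exact dotProduct_self_eq_zero.1 (le_antisymm h3 h4)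
  simpa using LinearMap.finrank_le_finrank_of_injective hf

end Matrix

/-! ### From the manifold to a chart -/

theorem SpaceForm.form_symm (N : SpaceForm) (d s : ℕ) (u v : N.Ambient d) :
    N.form d s u v = N.form d s v u :=
  pseudoInner_symm _ _ _ _

theorem SpaceForm.curvature_mul_form_self (N : SpaceForm) (d s : ℕ) {p : N.Ambient d}
    (hp : p ∈ N.carrier d s) : N.curvature * N.form d s p p = N.curvature * N.curvature := by
  cases N with
  | euclidean => simp [SpaceForm.curvature]
  | sphere =>
    have h : pseudoInner (d + 1) s p p = 1 := hp.1
    exact congrArg (1 * ·) h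
  | hyperbolic =>
    have h : pseudoInner (d + 1) (s + 1) p p = -1 := hp.1
    exact congrArg (-1 * ·) h

/-- The matrix normal form of type IV of index 1 of an endomorphism with matrix `A` and a bilinear
form with matrix `G`. -/
def Matrix.IsTypeIV {b : Type*} [Fintype b] [DecidableEq b] (A G : Matrix b b ℝ) : Prop :=
  ∃ (k : ℕ) (e : Matrix b (Fin 2 ⊕ Fin k) ℝ) (e' : Matrix (Fin 2 ⊕ Fin k) b ℝ) (α β : ℝ)
    (a : Fin k → ℝ), 0 < β ∧ e * e' = 1 ∧ e' * e = 1 ∧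
      A * e = e * fromBlocks !![α, -β; β, α] 0 0 (diagonal a) ∧
      eᵀ * G * e = fromBlocks !![-1, 0; 0, 1] 0 0 1

theorem IsTypeIVIndexOne.matrix {V W b : Type*} [Fintype b] [DecidableEq b] [AddCommGroup V]
    [Module ℝ V] [AddCommGroup W] [Module ℝ W] {A : Module.End ℝ V} {B : LinearMap.BilinForm ℝ V}
    (h : IsTypeIVIndexOne A B) (L : W ≃ₗ[ℝ] V) (v : Module.Basis b ℝ W) :
    Matrix.IsTypeIV (LinearMap.toMatrix v v (L.symm.conj A))
      (LinearMap.BilinForm.toMatrix v (B.compl₁₂ L.toLinearMap L.toLinearMap)) := by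
  obtain ⟨k, e, α, β, a, hβ, hA, hB⟩ := h
  refine ⟨k, v.toMatrix (e.map L.symm), (e.map L.symm).toMatrix v, α, β, a, hβ,
    Module.Basis.toMatrix_mul_toMatrix_flip _ _, Module.Basis.toMatrix_mul_toMatrix_flip _ _,
    ?_, ?_⟩
  · rw [linearMap_toMatrix_mul_basis_toMatrix, ← hA,
      ← basis_toMatrix_mul_linearMap_toMatrix (e.map L.symm) v (e.map L.symm)]
    congr 1
    ext i j
    simp [LinearMap.toMatrix_apply, LinearEquiv.conj_apply]
  · rw [LinearMap.BilinForm.toMatrix_mul_basis_toMatrix, ← hB]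
    ext i j
    simp [LinearMap.BilinForm.toMatrix_apply]

/-- The data of a hypersurface of type IV in a local chart: `φ` is the position vector, `ξ` the
unit normal and `A` the matrix of the shape operator. -/
structure LocalHypersurface (N : SpaceForm) (s n : ℕ) where
  U : Opens (EuclideanSpace ℝ (Fin n))
  φ : EuclideanSpace ℝ (Fin n) → N.Ambient (n + 1)
  ξ : EuclideanSpace ℝ (Fin n) → N.Ambient (n + 1)
  A : EuclideanSpace ℝ (Fin n) → Matrix (Fin n) (Fin n) ℝ
  φ_smooth : ContDiffOn ℝ ∞ φ U
  ξ_smooth : ContDiffOn ℝ ∞ ξ U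
  φ_mem : ∀ y ∈ U, N.curvature * N.form (n + 1) s (φ y) (φ y) = N.curvature * N.curvature
  φ_tangent : ∀ y ∈ U, ∀ v, N.curvature * N.form (n + 1) s (φ y) (fderiv ℝ φ y v) = 0
  ξ_tangent : ∀ y ∈ U, N.curvature * N.form (n + 1) s (ξ y) (φ y) = 0
  ξ_normal : ∀ y ∈ U, ∀ v, N.form (n + 1) s (ξ y) (fderiv ℝ φ y v) = 0
  ξ_unit : ∀ y ∈ U, N.form (n + 1) s (ξ y) (ξ y) = 1 ∨ N.form (n + 1) s (ξ y) (ξ y) = -1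
  shape : ∀ y ∈ U, ∀ i j, N.form (n + 1) s (fderiv ℝ φ y (EuclideanSpace.single i 1))
      (∑ k, A y k j • fderiv ℝ φ y (EuclideanSpace.single k 1))
    = -N.form (n + 1) s (fderiv ℝ φ y (EuclideanSpace.single i 1))
        (fderiv ℝ ξ y (EuclideanSpace.single j 1))
  typeIV : ∀ y ∈ U, Matrix.IsTypeIV (A y) (Matrix.of fun i j =>
    N.form (n + 1) s (fderiv ℝ φ y (EuclideanSpace.single i 1))
      (fderiv ℝ φ y (EuclideanSpace.single j 1)))
  roots : ∀ y ∈ U, ∀ z ∈ U, ((A y).charpoly.map (algebraMap ℝ ℂ)).roots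
    = ((A z).charpoly.map (algebraMap ℝ ℂ)).roots

namespace Hypersurface

variable {N : SpaceForm} {s n : ℕ} {M : Type*} [TopologicalSpace M]
  [ChartedSpace (EuclideanSpace ℝ (Fin n)) M]

theorem metric_shapeOperator (f : Hypersurface N s n M) (x : M) (v w : TangentSpace (𝓡 n) x) :
    f.metric x (f.shapeOperator x v) w = -N.form (n + 1) s (f.covDerivNormal x v) (f.dι x w) := by
  rw [shapeOperator, LinearMap.comp_apply, LinearEquiv.coe_toLinearMap,
    LinearMap.BilinForm.apply_toDual_symm_apply]
  rfl

/-- The chain rule with L the invertible differential of the inverse chart. One L serves all maps g,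
so ι and ξ are pulled back together. -/
theorem exists_mfderiv_equiv [IsManifold (𝓡 n) ∞ M] (x₀ : M) {y : EuclideanSpace ℝ (Fin n)}
    (hy : y ∈ (extChartAt (𝓡 n) x₀).target) :
    ∃ L : EuclideanSpace ℝ (Fin n) ≃L[ℝ] TangentSpace (𝓡 n) ((extChartAt (𝓡 n) x₀).symm y),
      ∀ {F : Type} [NormedAddCommGroup F] [NormedSpace ℝ F] (g : M → F),
        ContMDiff (𝓡 n) 𝓘(ℝ, F) ∞ g → ∀ v, fderiv ℝ (g ∘ (extChartAt (𝓡 n) x₀).symm) y v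
          = mfderiv (𝓡 n) 𝓘(ℝ, F) g ((extChartAt (𝓡 n) x₀).symm y) (L v) := by
  have : IsManifold (𝓡 n) 1 M := IsManifold.of_le (n := ∞) (by simp)
  obtain ⟨L, hL⟩ := isInvertible_mfderivWithin_extChartAt_symm (I := 𝓡 n) hy
  refine ⟨L, fun {F} _ _ g hg v => ?_⟩
  have h1 : MDifferentiableAt 𝓘(ℝ, EuclideanSpace ℝ (Fin n)) (𝓡 n)
      (extChartAt (𝓡 n) x₀).symm y :=
    ((contMDiffOn_extChartAt_symm (n := ∞) x₀).contMDiffAt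
      ((isOpen_extChartAt_target x₀).mem_nhds hy)).mdifferentiableAt (by simp)
  have h2 := hg.mdifferentiableAt (by simp) (x := (extChartAt (𝓡 n) x₀).symm y)
  rw [← mfderiv_eq_fderiv, mfderiv_comp y h2 h1]
  rw [ModelWithCorners.range_eq_univ, mfderivWithin_univ] at hL
  rw [← hL]
  rfl

theorem fderiv_form_self {F : Type*} [NormedAddCommGroup F] [NormedSpace ℝ F] {d : ℕ}
    (B : LinearMap.BilinForm ℝ (Fin d → ℝ)) (hB : ∀ u v, B u v = B v u) {g : F → Fin d → ℝ} {y : F}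
    (hg : DifferentiableAt ℝ g y) (v : F) :
    fderiv ℝ (fun z => B (g z) (g z)) y v = 2 * B (g y) (fderiv ℝ g y v) := by
  have h := (B.toContinuousBilinearMap).hasFDerivAt_of_bilinear hg.hasFDerivAt hg.hasFDerivAt
  have h' : HasFDerivAt (fun z => B (g z) (g z)) _ y := h
  rw [h'.fderiv]
  have : ∀ u w, B.toContinuousBilinearMap u w = B u w := fun _ _ => rfl
  simp [this]
  rw [hB (fderiv ℝ g y v), two_mul]

/-- A hypersurface of type IV can be expressed in a chart. -/
theorem exists_localHypersurface [IsManifold (𝓡 n) ∞ M] (f : Hypersurface N s n M)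
    (hf : f.IsIsoparametric) (hf' : f.IsPetrovTypeIVIndexOne) (x₀ : M) :
    ∃ H : LocalHypersurface N s n, (H.U : Set (EuclideanSpace ℝ (Fin n))).Nonempty := by
  classical
  set ψ := (extChartAt (𝓡 n) x₀).symm with hψ
  let U : Opens (EuclideanSpace ℝ (Fin n)) :=
    ⟨(extChartAt (𝓡 n) x₀).target, isOpen_extChartAt_target x₀⟩
  have hex := fun (y : EuclideanSpace ℝ (Fin n)) (hy : y ∈ U) => exists_mfderiv_equiv x₀ hy
  choose L hL using hex
  let b := (EuclideanSpace.basisFun (Fin n) ℝ).toBasis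
  have hb : ∀ i, b i = EuclideanSpace.single i 1 := fun i => by simp [b]
  -- The value 0 outside the chart is immaterial: every condition concerns points of U only.
  let A : EuclideanSpace ℝ (Fin n) → Matrix (Fin n) (Fin n) ℝ := fun y =>
    if hy : y ∈ U then LinearMap.toMatrix b b ((L y hy).symm.toLinearEquiv.conj
      (f.shapeOperator (ψ y))) else 0
  have hA : ∀ y (hy : y ∈ U), A y = LinearMap.toMatrix b b ((L y hy).symm.toLinearEquiv.conj
      (f.shapeOperator (ψ y))) := fun y hy => dif_pos hy
  have hψ' : ContMDiffOn 𝓘(ℝ, EuclideanSpace ℝ (Fin n)) (𝓡 n) ∞ ψ U :=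
    contMDiffOn_extChartAt_symm x₀
  have hφ : ContDiffOn ℝ ∞ (f.ι ∘ ψ) U :=
    contMDiffOn_iff_contDiffOn.1 (f.ι_smooth.comp_contMDiffOn hψ')
  have hξ : ContDiffOn ℝ ∞ (f.ξ ∘ ψ) U :=
    contMDiffOn_iff_contDiffOn.1 (f.ξ_smooth.comp_contMDiffOn hψ')
  have hφL : ∀ y (hy : y ∈ U) v, fderiv ℝ (f.ι ∘ ψ) y v = f.dι (ψ y) (L y hy v) :=
    fun y hy v => hL y hy f.ι f.ι_smooth v
  have hξL : ∀ y (hy : y ∈ U) v, fderiv ℝ (f.ξ ∘ ψ) y v = f.dξ (ψ y) (L y hy v) :=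
    fun y hy v => hL y hy f.ξ f.ξ_smooth v
  have hmem : ∀ y, N.curvature * N.form (n + 1) s (f.ι (ψ y)) (f.ι (ψ y))
      = N.curvature * N.curvature := fun y => N.curvature_mul_form_self _ _ (f.ι_mem _)
  have horth : ∀ y (hy : y ∈ U) v,
      N.curvature * N.form (n + 1) s (f.ι (ψ y)) (fderiv ℝ (f.ι ∘ ψ) y v) = 0 := by
    intro y hy v
    have hd : DifferentiableAt ℝ (f.ι ∘ ψ) y :=
      (hφ.contDiffAt (U.2.mem_nhds hy)).differentiableAt (by simp)
    have h := fderiv_form_self (N.curvature • N.form (n + 1) s)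
      (fun u v => congrArg (N.curvature * ·) (N.form_symm _ _ u v)) hd v
    have hc : (fun z => (N.curvature • N.form (n + 1) s) ((f.ι ∘ ψ) z) ((f.ι ∘ ψ) z))
        = fun _ => N.curvature * N.curvature := funext hmem
    rw [hc, fderiv_const_apply] at h
    have h2 : 2 * (N.curvature * N.form (n + 1) s (f.ι (ψ y)) (fderiv ℝ (f.ι ∘ ψ) y v)) = 0 :=
      h.symm
    linarith
  refine ⟨⟨U, f.ι ∘ ψ, f.ξ ∘ ψ, A, hφ, hξ, fun y _ => hmem y, horth, fun y _ => f.ξ_tangent _, ?_,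
    fun y _ => f.ξ_unit _, ?_, ?_, ?_⟩, ⟨_, mem_extChartAt_target x₀⟩⟩
  · intro y hy v
    rw [hφL y hy]
    exact f.ξ_normal _ _
  · intro y hy i j
    have h1 : ∑ k, A y k j • fderiv ℝ (f.ι ∘ ψ) y (EuclideanSpace.single k 1)
        = f.dι (ψ y) (f.shapeOperator (ψ y) (L y hy (EuclideanSpace.single j 1))) := by
      have h2 : ∑ k, A y k j • EuclideanSpace.single k (1 : ℝ)
          = (L y hy).symm (f.shapeOperator (ψ y) (L y hy (EuclideanSpace.single j 1))) := by
        simp only [hA y hy, ← hb, LinearMap.toMatrix_apply]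
        rw [b.sum_repr]
        rfl
      simp only [← map_smul, ← map_sum]
      rw [h2, hφL y hy, ContinuousLinearEquiv.apply_symm_apply]
    have h3 := f.metric_shapeOperator (ψ y) (L y hy (EuclideanSpace.single j 1))
      (L y hy (EuclideanSpace.single i 1))
    have h4 := horth y hy (EuclideanSpace.single i 1)
    rw [h1, hφL y hy, hξL y hy, N.form_symm]
    rw [hφL y hy] at h4
    refine h3.trans ?_
    rw [covDerivNormal, LinearMap.comp_apply, SpaceForm.tangentProj, N.form_symm]
    simp only [LinearMap.sub_apply, LinearMap.id_apply, LinearMap.smul_apply,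
      LinearMap.smulRight_apply, map_sub, map_smul, smul_eq_mul]
    -- The projection onto the tangent space of the space form changes dξ by a multiple of κφ only,
    -- and κ⟨φ, dφ⟩ = 0; so the flat derivative of ξ may be used.
    rw [N.form_symm _ _ _ (f.ι (ψ y)), mul_left_comm, h4, mul_zero, sub_zero]
  · intro y hy
    have h := (hf' (ψ y)).matrix (L y hy).toLinearEquiv b
    have h1 : (Matrix.of fun i j =>
        N.form (n + 1) s (fderiv ℝ (f.ι ∘ ψ) y (EuclideanSpace.single i 1))
          (fderiv ℝ (f.ι ∘ ψ) y (EuclideanSpace.single j 1)))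
        = LinearMap.BilinForm.toMatrix b ((f.metric (ψ y)).compl₁₂
          (L y hy).toLinearEquiv.toLinearMap (L y hy).toLinearEquiv.toLinearMap) := by
      ext i j
      rw [Matrix.of_apply, LinearMap.BilinForm.toMatrix_apply, hφL y hy, hφL y hy, hb, hb]
      rfl
    rw [hA y hy, h1]
    exact h
  · intro y hy z hz
    have h : ∀ y (hy : y ∈ U), (A y).charpoly = (f.shapeOperator (ψ y)).charpoly := by
      intro y hy
      rw [hA y hy, LinearMap.charpoly_toMatrix]
      exact LinearEquiv.charpoly_conj _ _
    rw [h y hy, h z hz]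
    exact hf _ _

end Hypersurface

/-! ### Complex diagonalization of the type IV normal form -/

namespace Matrix

section Field

variable {K : Type*} [Field K] {a b c J : Type*} [Fintype a] [Fintype b] [Fintype c] [Fintype J]
  [DecidableEq a] [DecidableEq b] [DecidableEq c] [DecidableEq J]

theorem card_eq_of_mul_eq_one [CharZero K] {S : Matrix b J K} {S' : Matrix J b K}
    (h : S * S' = 1) (h' : S' * S = 1) : Fintype.card b = Fintype.card J := by
  have := Matrix.trace_mul_comm S S'
  rw [h, h', trace_one, trace_one] at this
  exact_mod_cast this

theorem SimpleDiagonalization.charpoly_eq_prod [CharZero K] {A : Matrix b b K} {S : Matrix b J K}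
    {S' : Matrix J b K} {l : J → K} {o : J} (h : SimpleDiagonalization A S S' l o) :
    A.charpoly = ∏ j, (Polynomial.X - Polynomial.C (l j)) := by
  have hA : A = S * (diagonal l * S') := by
    rw [← Matrix.mul_assoc, ← h.mul_eq, Matrix.mul_assoc, h.mul_inv, Matrix.mul_one]
  have h1 := charpoly_mul_comm' S (diagonal l * S')
  rw [← hA, card_eq_of_mul_eq_one h.mul_inv h.inv_mul, Matrix.mul_assoc, h.inv_mul,
    Matrix.mul_one] at h1
  rw [mul_left_cancel₀ (pow_ne_zero _ Polynomial.X_ne_zero) h1, charpoly_diagonal]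

theorem SimpleDiagonalization.roots_charpoly [CharZero K] {A : Matrix b b K} {S : Matrix b J K}
    {S' : Matrix J b K} {l : J → K} {o : J} (h : SimpleDiagonalization A S S' l o) :
    A.charpoly.roots = Finset.univ.val.map l := by
  rw [h.charpoly_eq_prod]
  have h2 := Polynomial.roots_multiset_prod_X_sub_C (Finset.univ.val.map l)
  rwa [Multiset.map_map] at h2

omit [Fintype J] [DecidableEq J] [DecidableEq a] in
theorem gram_fromCols_det_ne_zero {η : Matrix a a K} (hη : ηᵀ = η) {Φ : Matrix a b K}
    {ν : Matrix a c K} (h : νᵀ * η * Φ = 0) (hΦ : (Φᵀ * η * Φ).det ≠ 0)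
    (hν : (νᵀ * η * ν).det ≠ 0) : ((fromCols Φ ν)ᵀ * η * fromCols Φ ν).det ≠ 0 := by
  have h' : Φᵀ * η * ν = 0 := by
    rw [← Matrix.transpose_eq_zero, Matrix.transpose_mul, Matrix.transpose_mul,
      Matrix.transpose_transpose, hη, ← Matrix.mul_assoc, h]
  rw [transpose_fromCols, fromRows_mul, fromRows_mul_fromCols, h, h', det_fromBlocks_zero₂₁]
  exact mul_ne_zero hΦ hν

theorem det_ne_zero_of_mul_eq_one {e : Matrix b J K} {e' : Matrix J b K} {G : Matrix b b K}
    (h : e * e' = 1) {D : Matrix J J K} (hD : D.det ≠ 0) (hG : eᵀ * G * e = D) : G.det ≠ 0 := by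
  have h1 : G * (e * (D⁻¹ * eᵀ)) = 1 := by
    have h2 : e'ᵀ * eᵀ = 1 := by rw [← Matrix.transpose_mul, h, Matrix.transpose_one]
    calc G * (e * (D⁻¹ * eᵀ)) = e'ᵀ * eᵀ * (G * (e * (D⁻¹ * eᵀ))) := by rw [h2, Matrix.one_mul]
      _ = e'ᵀ * (eᵀ * G * e * (D⁻¹ * eᵀ)) := by simp only [Matrix.mul_assoc]
      _ = e'ᵀ * (D * D⁻¹ * eᵀ) := by rw [hG, Matrix.mul_assoc D]
      _ = 1 := by rw [mul_nonsing_inv _ (isUnit_iff_ne_zero.2 hD), Matrix.one_mul, h2]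
  exact ((isUnit_iff_isUnit_det _).1 (IsUnit.of_mul_eq_one _ h1)).ne_zero

end Field

theorem map_ofReal_mul {a b c : Type*} [Fintype b] (A : Matrix a b ℝ) (B : Matrix b c ℝ) :
    (A * B).map Complex.ofReal = A.map Complex.ofReal * B.map Complex.ofReal :=
  Matrix.map_mul (f := Complex.ofRealHom)

theorem det_map_ofReal_ne_zero {J : Type*} [Fintype J] [DecidableEq J] {M : Matrix J J ℝ}
    (hM : M.det ≠ 0) : (M.map Complex.ofReal).det ≠ 0 := by
  have h := (RingHom.map_det Complex.ofRealHom M).symm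
  rw [RingHom.mapMatrix_apply] at h
  change (M.map Complex.ofRealHom).det ≠ 0
  rw [h]
  exact Complex.ofReal_ne_zero.2 hM

/-- The eigenvalues `α + iβ`, `α - iβ`, `a_1, …, a_k`. -/
def typeIVEigenvalues {k : ℕ} (α β : ℝ) (a : Fin k → ℝ) : Fin 2 ⊕ Fin k → ℂ :=
  Sum.elim ![⟨α, β⟩, ⟨α, -β⟩] fun i => a i

variable {b : Type*} [Fintype b] [DecidableEq b]

theorem IsTypeIV.det_ne_zero {A G : Matrix b b ℝ} (h : IsTypeIV A G) : G.det ≠ 0 := by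
  obtain ⟨k, e, e', α, β, a, hβ, h1, h2, hA, hG⟩ := h
  refine det_ne_zero_of_mul_eq_one h1 ?_ hG
  rw [det_fromBlocks_zero₂₁, det_fin_two]
  simp

/-- The vectors e₁ ∓ i e₂ diagonalize the rotation block with eigenvalues α ± iβ, and ⟨e₁ - i e₂, e₁
- i e₂⟩ = -1 - 1 = -2, so this eigenvector can be normalized. -/
theorem IsTypeIV.exists_diagonalization {A G : Matrix b b ℝ} (h : IsTypeIV A G) :
    ∃ (k : ℕ) (S : Matrix b (Fin 2 ⊕ Fin k) ℂ) (S' : Matrix (Fin 2 ⊕ Fin k) b ℂ) (α β : ℝ)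
      (a : Fin k → ℝ), 0 < β ∧ SimpleDiagonalization (A.map Complex.ofReal) S S'
        (typeIVEigenvalues α β a) (.inl 0) ∧
        (Sᵀ * G.map Complex.ofReal * S) (.inl 0) (.inl 0) ≠ 0 := by
  obtain ⟨k, e, e', α, β, a, hβ, h1, h2, hA, hG⟩ := h
  let V : Matrix (Fin 2 ⊕ Fin k) (Fin 2 ⊕ Fin k) ℂ :=
    fromBlocks !![1, 1; -Complex.I, Complex.I] 0 0 1
  let V' : Matrix (Fin 2 ⊕ Fin k) (Fin 2 ⊕ Fin k) ℂ :=
    fromBlocks !![1 / 2, Complex.I / 2; 1 / 2, -Complex.I / 2] 0 0 1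
  have hVV' : V * V' = 1 := by
    simp only [V, V', fromBlocks_multiply, ← fromBlocks_one]
    congr 1 <;> simp
    ext i j
    fin_cases i <;> fin_cases j <;> simp <;> ring_nf <;> simp
  have hV'V := mul_eq_one_comm.1 hVV'
  have c1 : e.map Complex.ofReal * e'.map Complex.ofReal = 1 := by
    rw [← map_ofReal_mul, h1]; exact Matrix.map_one _ Complex.ofReal_zero Complex.ofReal_one
  have c2 : e'.map Complex.ofReal * e.map Complex.ofReal = 1 := by
    rw [← map_ofReal_mul, h2]; exact Matrix.map_one _ Complex.ofReal_zero Complex.ofReal_one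
  have cA := congrArg (fun M => M.map Complex.ofReal) hA
  have cG := congrArg (fun M => M.map Complex.ofReal) hG
  simp only [map_ofReal_mul] at cA cG
  refine ⟨k, e.map Complex.ofReal * V, V' * e'.map Complex.ofReal, α, β, a, hβ,
    ⟨?_, ?_, ?_, ?_⟩, ?_⟩
  · rw [Matrix.mul_assoc, ← Matrix.mul_assoc V, hVV', Matrix.one_mul, c1]
  · rw [Matrix.mul_assoc, ← Matrix.mul_assoc _ _ V, c2, Matrix.one_mul, hV'V]
  · rw [← Matrix.mul_assoc, cA, Matrix.mul_assoc, Matrix.mul_assoc]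
    congr 1
    have hd : diagonal (typeIVEigenvalues α β a)
        = fromBlocks (diagonal ![⟨α, β⟩, ⟨α, -β⟩]) 0 0 (diagonal fun i => (a i : ℂ)) := by
      rw [fromBlocks_diagonal]; rfl
    rw [hd, fromBlocks_map, fromBlocks_multiply, fromBlocks_multiply]
    congr 1 <;> simp
    · ext i j
      fin_cases i <;> fin_cases j <;>
        simp [Complex.ext_iff, Matrix.mul_apply, Fin.sum_univ_two, vecMul_diagonal]
  -- Simplicity: no other eigenvalue has positive imaginary part.
  · have hi : ∀ z : ℂ, z = ⟨α, β⟩ → 0 < z.im := fun z hz => by rw [hz]; exact hβ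
    rintro (j | j) hj h
    · fin_cases j
      · exact hj rfl
      · have := hi _ h
        simp [typeIVEigenvalues] at this
        linarith
    · have := hi _ h
      simp [typeIVEigenvalues] at this
  · rw [Matrix.transpose_mul]
    have : Vᵀ * (e.map Complex.ofReal)ᵀ * G.map Complex.ofReal * (e.map Complex.ofReal * V)
        = Vᵀ * ((eᵀ).map Complex.ofReal * G.map Complex.ofReal * e.map Complex.ofReal) * V := by
      simp only [Matrix.mul_assoc]; rfl
    rw [this, cG]
    simp only [V, fromBlocks_map, fromBlocks_transpose, fromBlocks_multiply, fromBlocks_apply₁₁]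
    simp [Matrix.mul_apply, Fin.sum_univ_two]

end Matrix

/-! ### The ambient form as a matrix -/

namespace SpaceForm

variable (N : SpaceForm) (s n : ℕ)

/-- The matrix of the form of the ambient space. -/
def formMatrix (K : Type*) [Field K] :
    Matrix (Fin (N.ambientDim (n + 1))) (Fin (N.ambientDim (n + 1))) K :=
  diagonal fun i => if (i : ℕ) < N.ambientIndex s then -1 else 1

theorem pair_apply {c d : Type*} (P : Matrix (Fin (N.ambientDim (n + 1))) c ℝ)
    (Q : Matrix (Fin (N.ambientDim (n + 1))) d ℝ) (i : c) (j : d) :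
    (Pᵀ * N.formMatrix s n ℝ * Q) i j = N.form (n + 1) s (fun k => P k i) (fun k => Q k j) := by
  rw [form, pseudoInner, Matrix.toBilin'_apply', Matrix.mul_assoc, Matrix.mul_apply]
  refine Finset.sum_congr rfl fun k _ => ?_
  rw [formMatrix, diagonal_mul, mulVec_diagonal, Matrix.transpose_apply]

theorem formMatrix_mul_self (K : Type*) [Field K] :
    N.formMatrix s n K * N.formMatrix s n K = 1 := by
  rw [formMatrix, diagonal_mul_diagonal, ← diagonal_one]
  congr 1
  funext i
  split_ifs <;> simp

theorem formMatrix_transpose (K : Type*) [Field K] :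
    (N.formMatrix s n K)ᵀ = N.formMatrix s n K :=
  diagonal_transpose _

theorem formMatrix_map : (N.formMatrix s n ℝ).map Complex.ofReal = N.formMatrix s n ℂ := by
  rw [formMatrix, diagonal_map Complex.ofReal_zero, formMatrix]
  congr 1
  funext i
  split_ifs <;> simp

theorem curvature_cases : (N.curvature = 0 ∧ N.ambientDim (n + 1) = n + 1) ∨
    (N.curvature ≠ 0 ∧ N.ambientDim (n + 1) = n + 2) := by
  cases N
  · exact .inl ⟨rfl, rfl⟩
  · exact .inr ⟨by simp [curvature], rfl⟩
  · exact .inr ⟨by simp [curvature], rfl⟩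

theorem curvature_cube : N.curvature * N.curvature * N.curvature = N.curvature := by
  cases N <;> simp [curvature]

end SpaceForm

/-! ### Orthogonality relations in a chart and the sign of the normal -/

namespace LocalHypersurface

variable {N : SpaceForm} {s n : ℕ} (H : LocalHypersurface N s n)

/-- The position vector as a column. -/
def colφ (y : EuclideanSpace ℝ (Fin n)) : Matrix (Fin (N.ambientDim (n + 1))) Unit ℝ :=
  Matrix.of fun i _ => H.φ y i

/-- The unit normal as a column. -/
def colξ (y : EuclideanSpace ℝ (Fin n)) : Matrix (Fin (N.ambientDim (n + 1))) Unit ℝ :=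
  Matrix.of fun i _ => H.ξ y i

/-- The Jacobian matrix of the position vector. -/
def jacφ (y : EuclideanSpace ℝ (Fin n)) : Matrix (Fin (N.ambientDim (n + 1))) (Fin n) ℝ :=
  Matrix.of fun i j => fderiv ℝ H.φ y (EuclideanSpace.single j 1) i

/-- The Jacobian matrix of the unit normal. -/
def jacξ (y : EuclideanSpace ℝ (Fin n)) : Matrix (Fin (N.ambientDim (n + 1))) (Fin n) ℝ :=
  Matrix.of fun i j => fderiv ℝ H.ξ y (EuclideanSpace.single j 1) i

/-- The matrix of the metric. -/
def gram (y : EuclideanSpace ℝ (Fin n)) : Matrix (Fin n) (Fin n) ℝ :=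
  (H.jacφ y)ᵀ * N.formMatrix s n ℝ * H.jacφ y

/-- The square of the unit normal. -/
def sign (y : EuclideanSpace ℝ (Fin n)) : ℝ := N.form (n + 1) s (H.ξ y) (H.ξ y)

variable {y : EuclideanSpace ℝ (Fin n)}

theorem sign_mul_self (hy : y ∈ H.U) : H.sign y * H.sign y = 1 := by
  rcases H.ξ_unit y hy with h | h <;> simp [sign, h]

theorem sign_ne_zero (hy : y ∈ H.U) : H.sign y ≠ 0 := by
  rcases H.ξ_unit y hy with h | h <;> simp [sign, h]

theorem colξ_jacφ (hy : y ∈ H.U) : (H.colξ y)ᵀ * N.formMatrix s n ℝ * H.jacφ y = 0 := by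
  ext i j
  rw [N.pair_apply]
  exact H.ξ_normal y hy _

theorem colξ_colξ (y : EuclideanSpace ℝ (Fin n)) :
    (H.colξ y)ᵀ * N.formMatrix s n ℝ * H.colξ y = H.sign y • 1 := by
  ext i j
  rw [N.pair_apply]
  simp [colξ, sign]

theorem colξ_colφ (hy : y ∈ H.U) :
    N.curvature • ((H.colξ y)ᵀ * N.formMatrix s n ℝ * H.colφ y) = 0 := by
  ext i j
  rw [Matrix.smul_apply, N.pair_apply]
  exact H.ξ_tangent y hy

theorem colφ_colφ (hy : y ∈ H.U) :
    N.curvature • ((H.colφ y)ᵀ * N.formMatrix s n ℝ * H.colφ y)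
      = (N.curvature * N.curvature) • 1 := by
  ext i j
  rw [Matrix.smul_apply, N.pair_apply]
  exact (H.φ_mem y hy).trans (by simp)

theorem colφ_jacφ (hy : y ∈ H.U) :
    N.curvature • ((H.colφ y)ᵀ * N.formMatrix s n ℝ * H.jacφ y) = 0 := by
  ext i j
  rw [Matrix.smul_apply, N.pair_apply]
  exact H.φ_tangent y hy _

theorem gram_eq (y : EuclideanSpace ℝ (Fin n)) :
    H.gram y = Matrix.of fun i j =>
      N.form (n + 1) s (fderiv ℝ H.φ y (EuclideanSpace.single i 1))
        (fderiv ℝ H.φ y (EuclideanSpace.single j 1)) := by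
  ext i j
  exact N.pair_apply _ _ _ _ _ _

theorem isTypeIV (hy : y ∈ H.U) : Matrix.IsTypeIV (H.A y) (H.gram y) := by
  rw [gram_eq]
  exact H.typeIV y hy

theorem gram_mul_A (hy : y ∈ H.U) :
    H.gram y * H.A y = -((H.jacφ y)ᵀ * N.formMatrix s n ℝ * H.jacξ y) := by
  ext i j
  rw [gram, Matrix.mul_assoc, N.pair_apply, Matrix.neg_apply, N.pair_apply]
  have h : (fun k => (H.jacφ y * H.A y) k j)
      = ∑ k, H.A y k j • fderiv ℝ H.φ y (EuclideanSpace.single k 1) := by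
    funext r
    rw [Matrix.mul_apply, Finset.sum_apply]
    exact Finset.sum_congr rfl fun k _ => mul_comm _ _
  rw [h]
  exact H.shape y hy i j

/-- The tangent space, the normal and, if `κ ≠ 0`, the position vector span the ambient space. -/
theorem span (hy : y ∈ H.U) {u : Matrix (Fin (N.ambientDim (n + 1))) Unit ℂ}
    (h1 : uᵀ * N.formMatrix s n ℂ * (H.jacφ y).map Complex.ofReal = 0)
    (h2 : uᵀ * N.formMatrix s n ℂ * (H.colξ y).map Complex.ofReal = 0)
    (h3 : (N.curvature : ℂ) • (uᵀ * N.formMatrix s n ℂ * (H.colφ y).map Complex.ofReal) = 0) :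
    u = 0 := by
  have hmap : ∀ {c d : Type} (P : Matrix (Fin (N.ambientDim (n + 1))) c ℝ)
      (Q : Matrix (Fin (N.ambientDim (n + 1))) d ℝ),
      (P.map Complex.ofReal)ᵀ * N.formMatrix s n ℂ * Q.map Complex.ofReal
        = (Pᵀ * N.formMatrix s n ℝ * Q).map Complex.ofReal := by
    intro c d P Q
    rw [map_ofReal_mul, map_ofReal_mul, N.formMatrix_map]
    rfl
  have hΦ := (H.isTypeIV hy).det_ne_zero
  have hΦξ : ((fromCols (H.jacφ y) (H.colξ y))ᵀ * N.formMatrix s n ℝ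
      * fromCols (H.jacφ y) (H.colξ y)).det ≠ 0 := by
    refine gram_fromCols_det_ne_zero (N.formMatrix_transpose s n ℝ) (H.colξ_jacφ hy) hΦ ?_
    rw [H.colξ_colξ]
    simpa using H.sign_ne_zero hy
  have hu : uᵀ * N.formMatrix s n ℂ
      * (fromCols (H.jacφ y) (H.colξ y)).map Complex.ofReal = 0 := by
    have : (fromCols (H.jacφ y) (H.colξ y)).map Complex.ofReal
        = fromCols ((H.jacφ y).map Complex.ofReal) ((H.colξ y).map Complex.ofReal) := by
      ext i (j | j) <;> rfl
    rw [this, mul_fromCols, h1, h2, fromCols_zero]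
  -- In the flat case the n tangent vectors and ξ already fill the ambient dimension n + 1;
  -- otherwise φ is the missing column in dimension n + 2.
  rcases N.curvature_cases n with ⟨hκ, hd⟩ | ⟨hκ, hd⟩
  · refine eq_zero_of_isUnit_gram (N.formMatrix_mul_self s n ℂ) ?_ ?_ hu
    · simp [hd]
    · rw [hmap]
      exact det_map_ofReal_ne_zero hΦξ
  · have hφξ : (H.colξ y)ᵀ * N.formMatrix s n ℝ * H.colφ y = 0 :=
      (smul_eq_zero.1 (H.colξ_colφ hy)).resolve_left hκ
    have hφφ : (H.colφ y)ᵀ * N.formMatrix s n ℝ * H.jacφ y = 0 :=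
      (smul_eq_zero.1 (H.colφ_jacφ hy)).resolve_left hκ
    have hφξ' : (H.colφ y)ᵀ * N.formMatrix s n ℝ * H.colξ y = 0 := by
      rw [← Matrix.transpose_eq_zero, Matrix.transpose_mul, Matrix.transpose_mul,
        Matrix.transpose_transpose, N.formMatrix_transpose, ← Matrix.mul_assoc, hφξ]
    refine eq_zero_of_isUnit_gram (N.formMatrix_mul_self s n ℂ)
      (Ψ := (fromCols (fromCols (H.jacφ y) (H.colξ y)) (H.colφ y)).map Complex.ofReal) ?_ ?_ ?_
    · simp [hd]
    · rw [hmap]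
      refine det_map_ofReal_ne_zero (gram_fromCols_det_ne_zero (N.formMatrix_transpose s n ℝ)
        ?_ hΦξ ?_)
      · rw [mul_fromCols, hφξ', hφφ, fromCols_zero]
      · have h4 := H.colφ_colφ hy
        rw [mul_smul] at h4
        rw [smul_right_injective _ hκ h4]
        simpa using hκ
    · have : (fromCols (fromCols (H.jacφ y) (H.colξ y)) (H.colφ y)).map Complex.ofReal
          = fromCols ((fromCols (H.jacφ y) (H.colξ y)).map Complex.ofReal)
            ((H.colφ y).map Complex.ofReal) := by
        ext i (j | j) <;> rfl
      rw [this, mul_fromCols, hu, (smul_eq_zero.1 h3).resolve_left (by exact_mod_cast hκ),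
        fromCols_zero]

/-- An adapted frame of the tangent space and the normal is orthogonal. -/
theorem exists_frame (hy : y ∈ H.U) : ∃ (k : ℕ)
    (v : Matrix (Fin (N.ambientDim (n + 1))) ((Fin 2 ⊕ Fin k) ⊕ Unit) ℝ), n = k + 2 ∧
      vᵀ * N.formMatrix s n ℝ * v
        = diagonal (Sum.elim (Sum.elim ![-1, 1] fun _ => 1) fun _ => H.sign y) := by
  obtain ⟨k, e, e', α, β, a, hβ, h1, h2, hA, hG⟩ := H.isTypeIV hy
  refine ⟨k, fromCols (H.jacφ y * e) (H.colξ y), ?_, ?_⟩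
  · have := card_eq_of_mul_eq_one h1 h2
    simp at this
    omega
  · have h3 : (H.colξ y)ᵀ * N.formMatrix s n ℝ * (H.jacφ y * e) = 0 := by
      rw [← Matrix.mul_assoc, H.colξ_jacφ hy, Matrix.zero_mul]
    have h4 : (H.jacφ y * e)ᵀ * N.formMatrix s n ℝ * H.colξ y = 0 := by
      rw [← Matrix.transpose_eq_zero, Matrix.transpose_mul, Matrix.transpose_mul,
        Matrix.transpose_transpose, N.formMatrix_transpose, ← Matrix.mul_assoc, h3]
    have h5 : (H.jacφ y * e)ᵀ * N.formMatrix s n ℝ * (H.jacφ y * e)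
        = diagonal (Sum.elim ![-1, 1] fun _ => 1) := by
      rw [Matrix.transpose_mul]
      have : eᵀ * (H.jacφ y)ᵀ * N.formMatrix s n ℝ * (H.jacφ y * e) = eᵀ * H.gram y * e := by
        rw [gram]; simp only [Matrix.mul_assoc]
      rw [this, hG, ← fromBlocks_diagonal]
      congr 1
      ext i j
      fin_cases i <;> fin_cases j <;> rfl
    rw [transpose_fromCols, fromRows_mul, fromRows_mul_fromCols, h3, h4, h5, H.colξ_colξ,
      ← fromBlocks_diagonal (Sum.elim ![-1, 1] fun _ => 1), ← smul_one_eq_diagonal]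

/-- If ε = -1, the timelike tangent vector and ξ would be two orthogonal negative vectors in an
ambient space of index 1. The form is negated to count them as positive ones. -/
theorem sign_sphere (H : LocalHypersurface .sphere 1 n) (hy : y ∈ H.U) : H.sign y = 1 := by
  refine (H.ξ_unit y hy).resolve_right fun h => ?_
  obtain ⟨k, v, hk, hv⟩ := H.exists_frame hy
  rw [sign, h] at hv
  let d : Fin (SpaceForm.ambientDim .sphere (n + 1)) → ℝ :=
    fun i => if (i : ℕ) < 1 then (1 : ℝ) else -1
  let g : Fin 2 → (Fin 2 ⊕ Fin k) ⊕ Unit := ![.inl (.inl 0), .inr ()]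
  have hg : Function.Injective g := by
    intro i j hij
    fin_cases i <;> fin_cases j <;> first | rfl | cases hij
  have hv' : (v.submatrix id g)ᵀ
      * diagonal d
      * v.submatrix id g = 1 := by
    have h1 := congrArg (fun M => -(M.submatrix g g)) hv
    have h2 : diagonal d
        = -SpaceForm.formMatrix .sphere 1 n ℝ := by
      rw [SpaceForm.formMatrix, diagonal_neg]
      congr 1
      funext i
      change _ = -(if (i : ℕ) < 1 then (-1 : ℝ) else 1)
      simp only [d]
      split_ifs <;> simp
    rw [h2, Matrix.mul_neg, Matrix.neg_mul]
    refine h1.trans ?_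
    rw [submatrix_diagonal _ _ hg, diagonal_neg, ← diagonal_one]
    congr 1
    funext i
    fin_cases i <;> simp [g]
  have hc := card_le_of_gram_eq_one _ hv'
  have h3 : Fintype.card {i // 0 < d i} ≤ 1 := by
    refine Fintype.card_le_one_iff.2 fun i j => Subtype.ext (Fin.ext ?_)
    have : ∀ i : {i // 0 < d i},
        (i : ℕ) < 1 := fun i => by
      by_contra hi
      have : 0 < if (i.1 : ℕ) < 1 then (1 : ℝ) else -1 := i.2
      rw [if_neg hi] at this
      linarith
    have h1 := this i
    have h2 := this j
    omega
  simp only [Fintype.card_fin] at hc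
  exact absurd (hc.trans h3) (by norm_num)

/-- If ε = 1, the k + 1 spacelike tangent vectors and ξ would be k + 2 orthonormal vectors, while
the ambient space has dimension n + 2 = k + 4 and index 3, leaving room for k + 1. -/
theorem sign_hyperbolic (H : LocalHypersurface .hyperbolic 2 n) (hy : y ∈ H.U) :
    H.sign y = -1 := by
  refine (H.ξ_unit y hy).resolve_left fun h => ?_
  obtain ⟨k, v, hk, hv⟩ := H.exists_frame hy
  rw [sign, h] at hv
  let d : Fin (SpaceForm.ambientDim .hyperbolic (n + 1)) → ℝ :=
    fun i => if (i : ℕ) < 3 then (-1 : ℝ) else 1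
  let g : Fin 2 ⊕ Fin k → (Fin 2 ⊕ Fin k) ⊕ Unit :=
    Sum.elim ![.inl (.inl 1), .inr ()] fun i => .inl (.inr i)
  have hg : Function.Injective g := by
    rintro (i | i) (j | j) hij
    · fin_cases i <;> fin_cases j <;> first | rfl | cases hij
    · fin_cases i <;> cases hij
    · fin_cases j <;> cases hij
    · cases hij
      rfl
  have hv' : (v.submatrix id g)ᵀ
      * diagonal d
      * v.submatrix id g = 1 := by
    refine (congrArg (fun M => M.submatrix g g) hv).trans ?_
    rw [submatrix_diagonal _ _ hg, ← diagonal_one]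
    congr 1
    funext i
    rcases i with i | i
    · fin_cases i <;> simp [g]
    · rfl
  have hc := card_le_of_gram_eq_one _ hv'
  have h3 : Fintype.card {i // 0 < d i}
      ≤ k + 1 := by
    have hlt : ∀ i : {i // 0 < d i},
        3 ≤ (i : ℕ) := fun i => by
      by_contra hi
      have : 0 < if (i.1 : ℕ) < 3 then (-1 : ℝ) else 1 := i.2
      rw [if_pos (not_le.1 hi)] at this
      linarith
    have := Fintype.card_le_of_injective
      (fun i : {i // 0 < d i} =>
        (⟨i - 3, by have := hlt i; have : (i : ℕ) < n + 2 := i.1.2; omega⟩ : Fin (k + 1))) (by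
        intro i j hij
        have h1 := hlt i
        have h2 := hlt j
        have h4 : (i : ℕ) - 3 = (j : ℕ) - 3 := congrArg Fin.val hij
        exact Subtype.ext (Fin.ext (by omega)))
    simpa using this
  simp only [Fintype.card_sum, Fintype.card_fin] at hc
  omega

end LocalHypersurface

/-! ### From a chart to the ring of smooth functions -/

namespace smoothFunctions

variable {E : Type*} [NormedAddCommGroup E] [NormedSpace ℝ E] {U : Opens E} {a b c : Type*}

theorem matrix_ext {M M' : Matrix a b (smoothFunctions U)}
    (h : ∀ y, M.map (eval y) = M'.map (eval y)) : M = M' := by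
  ext1 i j
  exact eval_ext fun y => congrFun (congrFun (h y) i) j

theorem map_eval_mul [Fintype b] (M : Matrix a b (smoothFunctions U))
    (M' : Matrix b c (smoothFunctions U)) (y : U) :
    (M * M').map (eval y) = M.map (eval y) * M'.map (eval y) :=
  Matrix.map_mul (f := (eval y).toRingHom)

theorem map_eval_smul (r : smoothFunctions U) (M : Matrix a b (smoothFunctions U)) (y : U) :
    (r • M).map (eval y) = eval y r • M.map (eval y) := by
  ext i j
  simp

theorem map_eval_one [DecidableEq b] (y : U) :
    (1 : Matrix b b (smoothFunctions U)).map (eval y) = 1 :=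
  Matrix.map_one _ (map_zero _) (map_one _)

theorem eval_det [Fintype b] [DecidableEq b] (M : Matrix b b (smoothFunctions U)) (y : U) :
    eval y M.det = (M.map (eval y)).det :=
  RingHom.map_det (eval y).toRingHom M

theorem isUnit_det [Fintype b] [DecidableEq b] {M : Matrix b b (smoothFunctions U)}
    (h : ∀ y, (M.map (eval y)).det ≠ 0) : IsUnit M.det :=
  isUnit_of_eval_ne_zero fun y => by rw [eval_det]; exact h y

/-- The restriction of a real function. -/
def restrictReal (g : E → ℝ) (hg : ContDiffOn ℝ ∞ g U) : smoothFunctions U :=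
  restrict (fun y => (g y : ℂ)) (Complex.ofRealCLM.contDiff.comp_contDiffOn hg)

theorem eval_pderiv_restrictReal (v : E) (g : E → ℝ) (hg : ContDiffOn ℝ ∞ g U) (y : U) :
    eval y (pderiv U v (restrictReal g hg)) = (fderiv ℝ g y v : ℝ) := by
  refine (eval_pderiv_restrict v _ _ y).trans ?_
  have h : HasFDerivAt g (fderiv ℝ g y) (y : E) :=
    ((hg.contDiffAt (U.2.mem_nhds y.2)).differentiableAt (by simp)).hasFDerivAt
  exact congrArg (· v) (Complex.ofRealCLM.hasFDerivAt.comp (y : E) h).fderiv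

end smoothFunctions

namespace LocalHypersurface

open smoothFunctions Derivation

variable {N : SpaceForm} {s n : ℕ} (H : LocalHypersurface N s n)

/-- The local expression of a hypersurface as a hypersurface over a ring of smooth functions. -/
theorem exists_parametrized {V : Opens (EuclideanSpace ℝ (Fin n))} (hV : V ≤ H.U) :
    ∃ P : ParametrizedHypersurface (R := smoothFunctions V) (a := Fin (N.ambientDim (n + 1)))
      (fun i : Fin n => pderiv V (EuclideanSpace.single i 1)), ∀ y : V,
        P.G.map (eval y) = (H.gram y).map Complex.ofReal ∧
        P.A.map (eval y) = (H.A y).map Complex.ofReal ∧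
        eval y P.κ = N.curvature ∧ eval y P.ε = H.sign y := by
  let δ := fun i : Fin n => pderiv V (EuclideanSpace.single i 1)
  have sφ : ∀ i, ContDiffOn ℝ ∞ (fun y => H.φ y i) V := contDiffOn_pi.1 (H.φ_smooth.mono hV)
  have sξ : ∀ i, ContDiffOn ℝ ∞ (fun y => H.ξ y i) V := contDiffOn_pi.1 (H.ξ_smooth.mono hV)
  let φ : Matrix (Fin (N.ambientDim (n + 1))) Unit (smoothFunctions V) :=
    Matrix.of fun i _ => restrictReal (fun y => H.φ y i) (sφ i)
  let ξ : Matrix (Fin (N.ambientDim (n + 1))) Unit (smoothFunctions V) :=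
    Matrix.of fun i _ => restrictReal (fun y => H.ξ y i) (sξ i)
  let η : Matrix (Fin (N.ambientDim (n + 1))) (Fin (N.ambientDim (n + 1))) (smoothFunctions V) :=
    (N.formMatrix s n ℂ).map (algebraMap ℂ (smoothFunctions V))
  have eη : ∀ y : V, η.map (eval y) = N.formMatrix s n ℂ := fun y => by
    ext i j
    rfl
  have eφ : ∀ y : V, φ.map (eval y) = (H.colφ y).map Complex.ofReal := fun y => rfl
  have eξ : ∀ y : V, ξ.map (eval y) = (H.colξ y).map Complex.ofReal := fun y => rfl
  have coord : ∀ {g : EuclideanSpace ℝ (Fin n) → N.Ambient (n + 1)} (_ : ContDiffOn ℝ ∞ g V)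
      (y : V) (v) (i), fderiv ℝ (fun z => g z i) y v = fderiv ℝ g y v i := by
    intro g hg y v i
    have hd : DifferentiableAt ℝ g y :=
      (hg.contDiffAt (V.2.mem_nhds y.2)).differentiableAt (by simp)
    rw [fderiv_apply hd]
    rfl
  have eΦ : ∀ y : V, (jacobian δ φ).map (eval y) = (H.jacφ y).map Complex.ofReal := by
    intro y
    ext i j
    refine (eval_pderiv_restrictReal _ _ (sφ i) y).trans ?_
    rw [coord (H.φ_smooth.mono hV)]
    rfl
  have eΞ : ∀ y : V, (jacobian δ ξ).map (eval y) = (H.jacξ y).map Complex.ofReal := by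
    intro y
    ext i j
    refine (eval_pderiv_restrictReal _ _ (sξ i) y).trans ?_
    rw [coord (H.ξ_smooth.mono hV)]
    rfl
  have pair' : ∀ {c d : Type} (P : Matrix (Fin (N.ambientDim (n + 1))) c (smoothFunctions V))
      (Q : Matrix (Fin (N.ambientDim (n + 1))) d (smoothFunctions V)) (y : V),
      (Pᵀ * η * Q).map (eval y) = (P.map (eval y))ᵀ * N.formMatrix s n ℂ * Q.map (eval y) := by
    intro c d P Q y
    rw [map_eval_mul, map_eval_mul, eη]
    rfl
  have pair : ∀ {c d : Type} {P : Matrix (Fin (N.ambientDim (n + 1))) c (smoothFunctions V)}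
      {Q : Matrix (Fin (N.ambientDim (n + 1))) d (smoothFunctions V)} {y : V}
      {P' : Matrix (Fin (N.ambientDim (n + 1))) c ℝ} {Q' : Matrix (Fin (N.ambientDim (n + 1))) d ℝ},
      P.map (eval y) = P'.map Complex.ofReal → Q.map (eval y) = Q'.map Complex.ofReal →
      (Pᵀ * η * Q).map (eval y) = (P'ᵀ * N.formMatrix s n ℝ * Q').map Complex.ofReal := by
    intro c d P Q y P' Q' hP hQ
    rw [pair', hP, hQ, map_ofReal_mul, map_ofReal_mul, N.formMatrix_map]
    rfl
  let G := (jacobian δ φ)ᵀ * η * jacobian δ φ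
  have eG : ∀ y : V, G.map (eval y) = (H.gram y).map Complex.ofReal := fun y => pair (eΦ y) (eΦ y)
  have dG : ∀ y : V, ((H.gram y).map Complex.ofReal).det ≠ 0 := fun y =>
    det_map_ofReal_ne_zero (H.isTypeIV (hV y.2)).det_ne_zero
  have uG : IsUnit G.det := isUnit_det fun y => by rw [eG]; exact dG y
  -- The given matrix `H.A` is not assumed smooth; solving the shape equation with the invertible
  -- Gram matrix gives smooth entries, and uniqueness identifies the values.
  let A := -(G⁻¹ * ((jacobian δ φ)ᵀ * η * jacobian δ ξ))
  have hA : G * A = -((jacobian δ φ)ᵀ * η * jacobian δ ξ) := by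
    rw [Matrix.mul_neg, ← Matrix.mul_assoc, mul_nonsing_inv _ uG, Matrix.one_mul]
  have eA : ∀ y : V, A.map (eval y) = (H.A y).map Complex.ofReal := by
    intro y
    have h1 : (H.gram y).map Complex.ofReal * A.map (eval y)
        = (H.gram y).map Complex.ofReal * (H.A y).map Complex.ofReal := by
      rw [← eG, ← map_eval_mul, hA, eG, ← map_ofReal_mul, H.gram_mul_A (hV y.2)]
      have := pair (eΦ y) (eΞ y)
      ext i j
      have h2 := congrFun (congrFun this i) j
      simp only [Matrix.map_apply, Matrix.neg_apply, map_neg, Complex.ofReal_neg] at h2 ⊢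
      rw [h2]
    have h2 := nonsing_inv_mul _ (isUnit_iff_ne_zero.2 (dG y))
    calc A.map (eval y) = ((H.gram y).map Complex.ofReal)⁻¹
          * ((H.gram y).map Complex.ofReal * A.map (eval y)) := by
            rw [← Matrix.mul_assoc, h2, Matrix.one_mul]
      _ = _ := by rw [h1, ← Matrix.mul_assoc, h2, Matrix.one_mul]
  let κ := algebraMap ℂ (smoothFunctions V) N.curvature
  let ε := (ξᵀ * η * ξ) () ()
  have eκ : ∀ y : V, eval y κ = (N.curvature : ℂ) := fun y => rfl
  have eε : ∀ y : V, eval y ε = (H.sign y : ℂ) := by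
    intro y
    have h := congrFun (congrFun (pair (eξ y) (eξ y)) ()) ()
    rw [H.colξ_colξ] at h
    refine h.trans ?_
    simp
  have zero_map : ∀ {c d : Type} (y : V), (0 : Matrix c d (smoothFunctions V)).map (eval y) = 0 :=
    fun y => Matrix.map_zero _ (map_zero _)
  have zero_map' : ∀ {c d : Type}, (0 : Matrix c d ℝ).map Complex.ofReal = 0 :=
    Matrix.map_zero _ Complex.ofReal_zero
  have smul_map : ∀ {c d : Type} (r : ℝ) (M : Matrix c d ℝ),
      (r : ℂ) • M.map Complex.ofReal = (r • M).map Complex.ofReal := fun r M => by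
    ext i j
    simp
  refine ⟨⟨η, φ, ξ, A, κ, ε, fun i j r => pderiv_comm _ _ _, ?_, ?_, ?_, ?_, ?_, ?_, ?_, ?_, ?_, hA,
    ?_⟩, fun y => ⟨eG y, eA y, eκ y, eε y⟩⟩
  · refine matrix_ext fun y => ?_
    rw [eη]
    exact (congrArg Matrix.transpose (eη y)).trans (N.formMatrix_transpose s n ℂ)
  · intro j
    ext1 i k
    exact Derivation.map_algebraMap (δ j) (N.formMatrix s n ℂ i k)
  · intro j
    exact Derivation.map_algebraMap (δ j) (N.curvature : ℂ)
  · refine eval_ext fun y => ?_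
    rw [map_mul, map_mul, eκ]
    exact_mod_cast N.curvature_cube
  · refine eval_ext fun y => ?_
    rw [map_mul, eε, map_one]
    exact_mod_cast H.sign_mul_self (hV y.2)
  · refine matrix_ext fun y => ?_
    rw [pair (eξ y) (eΦ y), H.colξ_jacφ (hV y.2), zero_map, zero_map']
  · ext1 i j
    simp [ε]
  · refine matrix_ext fun y => ?_
    rw [map_eval_smul, pair (eξ y) (eφ y), eκ, smul_map, H.colξ_colφ (hV y.2), zero_map, zero_map']
  · refine matrix_ext fun y => ?_
    rw [map_eval_smul, pair (eφ y) (eφ y), eκ, smul_map, H.colφ_colφ (hV y.2), map_eval_smul,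
      map_eval_one, map_mul, eκ, ← smul_map, Matrix.map_one _ Complex.ofReal_zero
        Complex.ofReal_one, Complex.ofReal_mul]
  · intro u h1 h2 h3
    refine matrix_ext fun y => ?_
    rw [zero_map]
    refine H.span (hV y.2) ?_ ?_ ?_
    · rw [← eΦ, ← pair', h1, zero_map]
    · rw [← eξ, ← pair', h2, zero_map]
    · rw [← eφ, ← pair', ← eκ y, ← map_eval_smul, h3, zero_map]

end LocalHypersurface

/-! ### The sign of the imaginary part -/

namespace Matrix

theorem aeval_mul_eigenvector {K b : Type*} [Field K] [Fintype b] [DecidableEq b]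
    {M : Matrix b b K} {X : Matrix b Unit K} {μ : K} (h : M * X = μ • X) (q : Polynomial K) :
    Polynomial.aeval M q * X = q.eval μ • X := by
  induction q using Polynomial.induction_on' with
  | add p q hp hq => rw [map_add, Matrix.add_mul, hp, hq, Polynomial.eval_add, add_smul]
  | monomial k c =>
    have hk : M ^ k * X = μ ^ k • X := by
      induction k with
      | zero => simp
      | succ k ih => rw [pow_succ, Matrix.mul_assoc, h, Matrix.mul_smul, ih, smul_smul, pow_succ']
    rw [Polynomial.aeval_monomial, Polynomial.eval_monomial, Algebra.algebraMap_eq_smul_one,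
      smul_mul_assoc, one_mul, Matrix.smul_mul, hk, smul_smul]

theorem eq_inl_zero_of_im_pos {k : ℕ} {α β : ℝ} {a : Fin k → ℝ} (hβ : 0 < β)
    {j : Fin 2 ⊕ Fin k} (hj : 0 < (typeIVEigenvalues α β a j).im) : j = .inl 0 := by
  rcases j with j | j
  · fin_cases j
    · rfl
    · simp [typeIVEigenvalues] at hj
      linarith
  · simp [typeIVEigenvalues] at hj

theorem typeIVEigenvalues_inl_zero {k : ℕ} (α β : ℝ) (a : Fin k → ℝ) :
    typeIVEigenvalues α β a (.inl 0) = ⟨α, β⟩ := rfl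

/-- The right hand side of Cartan's identity for the eigenvalue `α + iβ` does not vanish. -/
theorem typeIV_sum_ne_zero {k : ℕ} {α β : ℝ} (a : Fin k → ℝ) (hβ : 0 < β) {ε κ : ℝ}
    (hε : ε * ε = 1) (hκ : 0 ≤ κ * ε) :
    ∑ j ∈ Finset.univ.erase (.inl 0),
      ((ε * (⟨α, β⟩ : ℂ)) * typeIVEigenvalues α β a j + κ)
        / (⟨α, β⟩ - typeIVEigenvalues α β a j) ≠ 0 := by
  intro h
  -- Multiplying by ε replaces εμλ + κ by μλ + κε, so that only the sign of κε matters.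
  have h1 : ∑ j ∈ Finset.univ.erase (.inl 0), (ε : ℂ) * (((ε * (⟨α, β⟩ : ℂ))
      * typeIVEigenvalues α β a j + κ) / (⟨α, β⟩ - typeIVEigenvalues α β a j)) = 0 := by
    rw [← Finset.mul_sum, h, mul_zero]
  have h2 : ∀ l : ℂ, (ε : ℂ) * (((ε * (⟨α, β⟩ : ℂ)) * l + κ) / (⟨α, β⟩ - l))
      = ((⟨α, β⟩ : ℂ) * l + (κ * ε : ℝ)) / (⟨α, β⟩ - l) := by
    intro l
    have : (ε : ℂ) * ε = 1 := by exact_mod_cast hε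
    rw [← mul_div_assoc, mul_add, ← mul_assoc, ← mul_assoc, this, one_mul, Complex.ofReal_mul,
      mul_comm (ε : ℂ)]
  simp only [h2] at h1
  have h3 := congrArg Complex.im h1
  rw [Complex.im_sum, Complex.zero_im] at h3
  have hreal : ∀ i, (((⟨α, β⟩ : ℂ) * (a i : ℂ) + (κ * ε : ℝ)) / (⟨α, β⟩ - (a i : ℂ))).im ≤ 0 := by
    intro i
    rw [Complex.div_im, ← sub_div]
    refine div_nonpos_of_nonpos_of_nonneg ?_ (Complex.normSq_nonneg _)
    simp
    nlinarith [mul_nonneg hβ.le (add_nonneg (mul_self_nonneg (a i)) hκ)]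
  have hconj : (((⟨α, β⟩ : ℂ) * (⟨α, -β⟩ : ℂ) + (κ * ε : ℝ)) / (⟨α, β⟩ - ⟨α, -β⟩)).im < 0 := by
    rw [Complex.div_im, ← sub_div]
    refine div_neg_of_neg_of_pos ?_ (Complex.normSq_pos.2 fun h => ?_)
    · simp
      nlinarith [mul_pos hβ hβ, mul_pos hβ (mul_pos hβ hβ), mul_self_nonneg α,
        mul_nonneg hβ.le (add_nonneg (mul_self_nonneg α) hκ)]
    · have := congrArg Complex.im h
      simp at this
      linarith
  refine absurd h3 (ne_of_lt ?_)
  refine Finset.sum_neg' (fun j hj => ?_) ⟨.inl 1, by simp, hconj⟩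
  rcases j with j | j
  · fin_cases j
    · simp at hj
    · exact hconj.le
  · exact hreal j

end Matrix

/-! ### The complex eigenvector field and the contradiction -/

namespace LocalHypersurface

open smoothFunctions Derivation

variable {N : SpaceForm} {s n : ℕ} (H : LocalHypersurface N s n)

/-- The complex matrix of the shape operator. -/
def complexA (y : EuclideanSpace ℝ (Fin n)) : Matrix (Fin n) (Fin n) ℂ :=
  (H.A y).map Complex.ofReal

/-- The complex matrix of the metric. -/
def complexGram (y : EuclideanSpace ℝ (Fin n)) : Matrix (Fin n) (Fin n) ℂ :=
  (H.gram y).map Complex.ofReal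

theorem roots_complexA {y z : EuclideanSpace ℝ (Fin n)} (hy : y ∈ H.U) (hz : z ∈ H.U) :
    (H.complexA y).charpoly.roots = (H.complexA z).charpoly.roots := by
  have h := H.roots y hy z hz
  rwa [← charpoly_map, ← charpoly_map] at h

theorem charpoly_complexA {y z : EuclideanSpace ℝ (Fin n)} (hy : y ∈ H.U) (hz : z ∈ H.U) :
    (H.complexA y).charpoly = (H.complexA z).charpoly := by
  rw [(IsAlgClosed.splits (H.complexA y).charpoly).eq_prod_roots_of_monic (charpoly_monic _),
    (IsAlgClosed.splits (H.complexA z).charpoly).eq_prod_roots_of_monic (charpoly_monic _),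
    H.roots_complexA hy hz]

/-- The principal curvature with positive imaginary part is constant. -/
theorem exists_diagonalizations (hne : (H.U : Set (EuclideanSpace ℝ (Fin n))).Nonempty) :
    ∃ μ : ℂ, ∀ y ∈ H.U, ∃ (k : ℕ) (S : Matrix (Fin n) (Fin 2 ⊕ Fin k) ℂ)
      (S' : Matrix (Fin 2 ⊕ Fin k) (Fin n) ℂ) (α β : ℝ) (a : Fin k → ℝ), 0 < β ∧
        SimpleDiagonalization (H.complexA y) S S' (typeIVEigenvalues α β a) (.inl 0) ∧
        (Sᵀ * H.complexGram y * S) (.inl 0) (.inl 0) ≠ 0 ∧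
        typeIVEigenvalues α β a (.inl 0) = μ := by
  obtain ⟨z, hz⟩ := hne
  obtain ⟨k₀, S₀, S₀', α₀, β₀, a₀, hβ₀, h₀, -⟩ := (H.isTypeIV hz).exists_diagonalization
  refine ⟨⟨α₀, β₀⟩, fun y hy => ?_⟩
  obtain ⟨k, S, S', α, β, a, hβ, h, h'⟩ := (H.isTypeIV hy).exists_diagonalization
  refine ⟨k, S, S', α, β, a, hβ, h, h', ?_⟩
  have hr : Finset.univ.val.map (typeIVEigenvalues α β a)
      = Finset.univ.val.map (typeIVEigenvalues α₀ β₀ a₀) := by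
    rw [← h.roots_charpoly, ← h₀.roots_charpoly]
    exact H.roots_complexA hy hz
  have hmem : (⟨α₀, β₀⟩ : ℂ) ∈ Finset.univ.val.map (typeIVEigenvalues α β a) := by
    rw [hr]
    exact Multiset.mem_map.2 ⟨.inl 0, Finset.mem_univ_val _, rfl⟩
  obtain ⟨j, -, hj⟩ := Multiset.mem_map.1 hmem
  have : j = .inl 0 := eq_inl_zero_of_im_pos hβ (by rw [hj]; exact hβ₀)
  rw [← this, hj]

/-- Near every point there is a smooth normalized eigenvector field for the complex principal
curvature. -/
theorem exists_eigenfield {μ : ℂ} {y₀ : EuclideanSpace ℝ (Fin n)} (hy₀ : y₀ ∈ H.U) {J : Type}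
    [Fintype J] [DecidableEq J] {S : Matrix (Fin n) J ℂ} {S' : Matrix J (Fin n) ℂ} {l : J → ℂ}
    {o : J} (h : SimpleDiagonalization (H.complexA y₀) S S' l o)
    (hS : (Sᵀ * H.complexGram y₀ * S) o o ≠ 0) (hμ : l o = μ) :
    ∃ V : Opens (EuclideanSpace ℝ (Fin n)), V ≤ H.U ∧ y₀ ∈ V ∧
      ∃ X : Matrix (Fin n) Unit (smoothFunctions V), ∀ y : V,
        H.complexA y * X.map (eval y) = μ • X.map (eval y) ∧
        (X.map (eval y))ᵀ * H.complexGram y * X.map (eval y) = 1 := by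
  subst hμ
  obtain ⟨P, hP⟩ := H.exists_parametrized le_rfl
  -- With q the constant characteristic polynomial divided by X - μ, Cayley–Hamilton makes every
  -- column of q(A) a μ-eigenvector or zero. Applied to the fixed eigenvector at y₀, q(A) gives a
  -- smooth eigenvector field, whose value there is scaled by q(μ) ≠ 0.
  let q : Polynomial ℂ := ∏ j ∈ Finset.univ.erase o, (Polynomial.X - Polynomial.C (l j))
  have hq : q.eval (l o) ≠ 0 := by
    rw [Polynomial.eval_prod]
    refine Finset.prod_ne_zero_iff.2 fun j hj => ?_
    simpa using sub_ne_zero.2 (h.simple j (Finset.ne_of_mem_erase hj)).symm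
  have hchar : ∀ y ∈ H.U, (H.complexA y).charpoly
      = (Polynomial.X - Polynomial.C (l o)) * q := by
    intro y hy
    rw [H.charpoly_complexA hy hy₀, h.charpoly_eq_prod]
    exact (Finset.mul_prod_erase _ _ (Finset.mem_univ o)).symm
  have hker : ∀ y ∈ H.U, H.complexA y * Polynomial.aeval (H.complexA y) q
      = l o • Polynomial.aeval (H.complexA y) q := by
    intro y hy
    have h1 := aeval_self_charpoly (H.complexA y)
    rw [hchar y hy, map_mul, map_sub, Polynomial.aeval_X, Polynomial.aeval_C,
      Algebra.algebraMap_eq_smul_one, Matrix.sub_mul, Matrix.smul_mul, Matrix.one_mul,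
      sub_eq_zero] at h1
    exact h1
  let S₀ : Matrix (Fin n) Unit ℂ := Matrix.of fun i _ => S i o
  have hS₀ : H.complexA y₀ * S₀ = l o • S₀ := by
    ext i j
    have h1 := congrFun (congrFun h.mul_eq i) o
    rw [mul_diagonal, mul_comm] at h1
    exact h1
  let X₁ : Matrix (Fin n) Unit (smoothFunctions H.U) :=
    Polynomial.aeval P.A q * S₀.map (algebraMap ℂ (smoothFunctions H.U))
  have eX₁ : ∀ y : H.U, X₁.map (eval y) = Polynomial.aeval (H.complexA y) q * S₀ := by
    intro y
    have h1 : (Polynomial.aeval P.A q).map (eval y) = Polynomial.aeval (H.complexA y) q := by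
      have h2 := Polynomial.aeval_algHom_apply (AlgHom.mapMatrix (m := Fin n) (eval y)) P.A q
      rw [AlgHom.mapMatrix_apply, AlgHom.mapMatrix_apply, (hP y).2.1] at h2
      exact h2.symm
    rw [map_eval_mul, h1]
    rfl
  let ρ : smoothFunctions H.U := (X₁ᵀ * P.G * X₁) () ()
  have eρ : ∀ y : H.U, eval y ρ
      = ((X₁.map (eval y))ᵀ * H.complexGram y * X₁.map (eval y)) () () := by
    intro y
    have h1 : (X₁ᵀ * P.G * X₁).map (eval y)
        = (X₁.map (eval y))ᵀ * H.complexGram y * X₁.map (eval y) := by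
      rw [map_eval_mul, map_eval_mul, (hP y).1]
      rfl
    exact congrFun (congrFun h1 ()) ()
  let r : ℂ := eval ⟨y₀, hy₀⟩ ρ
  have hr : r ≠ 0 := by
    have h1 : (S₀ᵀ * H.complexGram y₀ * S₀) () () = (Sᵀ * H.complexGram y₀ * S) o o := rfl
    have h2 : r = q.eval (l o) * (q.eval (l o) * (S₀ᵀ * H.complexGram y₀ * S₀) () ()) := by
      refine (eρ _).trans ?_
      rw [eX₁, aeval_mul_eigenvector hS₀]
      simp only [Matrix.transpose_smul, Matrix.smul_mul, Matrix.mul_smul, Matrix.smul_apply,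
        smul_eq_mul]
    rw [h2, h1]
    exact mul_ne_zero hq (mul_ne_zero hq hS)
  -- A smooth square root of 1/ρ is needed. Dividing ρ by its value r at y₀ moves it to 1, where the
  -- principal logarithm is smooth; w is a square root of 1/r and restores the scale.
  obtain ⟨w, hw⟩ := IsAlgClosed.exists_pow_nat_eq r⁻¹ (n := 2) (by norm_num)
  have hρc : ContDiffOn ℝ ∞ (fun y => ext ρ y / r) H.U := (contDiffOn_ext ρ).div_const r
  let V : Opens (EuclideanSpace ℝ (Fin n)) :=
    ⟨H.U ∩ (fun y => ext ρ y / r) ⁻¹' Complex.slitPlane,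
      hρc.continuousOn.isOpen_inter_preimage H.U.2 Complex.isOpen_slitPlane⟩
  have hV : V ≤ H.U := fun y hy => hy.1
  let g : EuclideanSpace ℝ (Fin n) → ℂ := fun y =>
    w * Complex.exp (-(1 / 2) * Complex.log (ext ρ y / r))
  have hg : ContDiffOn ℝ ∞ g V := by
    have h1 : ContDiffOn ℝ ∞ (fun y => Complex.log (ext ρ y / r)) V := fun y hy =>
      ContDiffAt.comp_contDiffWithinAt (g := Complex.log) y
        ((Complex.contDiffAt_log (n := ∞) hy.2).restrict_scalars ℝ) ((hρc.mono hV) y hy)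
    exact contDiffOn_const.mul
      ((Complex.contDiff_exp (𝕜 := ℝ) (n := ∞)).comp_contDiffOn
        (contDiffOn_const.mul h1))
  have hgg : ∀ y : V, g y * (g y * ext ρ y) = 1 := by
    intro y
    have hne : ext ρ y / r ≠ 0 := Complex.slitPlane_ne_zero y.2.2
    have h1 : Complex.exp (-(1 / 2) * Complex.log (ext ρ y / r))
        * Complex.exp (-(1 / 2) * Complex.log (ext ρ y / r)) = (ext ρ y / r)⁻¹ := by
      rw [← Complex.exp_add, ← two_mul, ← mul_assoc,
        show (2 : ℂ) * -(1 / 2) = -1 by norm_num, neg_one_mul, Complex.exp_neg, Complex.exp_log hne]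
    calc g y * (g y * smoothFunctions.ext ρ (y : EuclideanSpace ℝ (Fin n)))
        = w ^ 2 * (Complex.exp (-(1 / 2) * Complex.log (ext ρ y / r))
          * Complex.exp (-(1 / 2) * Complex.log (ext ρ y / r))) * ext ρ y := by
            simp only [g]; ring
      _ = 1 := by
        have hne' : smoothFunctions.ext ρ (y : EuclideanSpace ℝ (Fin n)) ≠ 0 := fun h =>
          hne (by rw [h, zero_div])
        rw [h1, hw]
        field_simp
  let X : Matrix (Fin n) Unit (smoothFunctions V) := Matrix.of fun i _ =>
    restrict (fun y => g y * ext (X₁ i ()) y) (hg.mul ((contDiffOn_ext _).mono hV))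
  have eX : ∀ y : V, X.map (eval y) = g y • X₁.map (eval (⟨y.1, hV y.2⟩ : H.U)) := by
    intro y
    ext i j
    change g y * ext (X₁ i ()) (y : EuclideanSpace ℝ (Fin n)) = g y * _
    rw [ext_apply (X₁ i ()) ⟨y.1, hV y.2⟩]
    rfl
  refine ⟨V, hV, ⟨hy₀, ?_⟩, X, fun y => ⟨?_, ?_⟩⟩
  · change ext ρ y₀ / r ∈ Complex.slitPlane
    have h1 : ext ρ y₀ = r := ext_apply ρ ⟨y₀, hy₀⟩
    rw [h1, div_self hr]
    exact Complex.one_mem_slitPlane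
  · rw [eX, Matrix.mul_smul, eX₁, ← Matrix.mul_assoc, hker y (hV y.2), Matrix.smul_mul, smul_comm]
  · ext i j
    have h1 := eρ ⟨y.1, hV y.2⟩
    have h2 : ext ρ (y : EuclideanSpace ℝ (Fin n)) = eval ⟨y.1, hV y.2⟩ ρ :=
      ext_apply ρ ⟨y.1, hV y.2⟩
    have h3 := hgg y
    rw [h2, h1] at h3
    rw [eX]
    simp only [Matrix.transpose_smul, Matrix.smul_mul, Matrix.mul_smul, Matrix.smul_apply,
      smul_eq_mul]
    exact h3.trans (by simp)

/-- Cartan's identity, evaluated at one point in an eigenbasis, contradicts the sign of its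
imaginary part. Eigenbases are chosen point by point; only X has to be smooth. -/
theorem false_of_sign (hne : (H.U : Set (EuclideanSpace ℝ (Fin n))).Nonempty)
    (hsign : ∀ y ∈ H.U, 0 ≤ N.curvature * H.sign y) : False := by
  obtain ⟨μ, hμ⟩ := H.exists_diagonalizations hne
  obtain ⟨y₀, hy₀⟩ := hne
  obtain ⟨k, S, S', α, β, a, hβ, h, hS, hl⟩ := hμ y₀ hy₀
  obtain ⟨V, hV, hyV, X, hX⟩ := H.exists_eigenfield hy₀ h hS hl
  obtain ⟨P, hP⟩ := H.exists_parametrized hV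
  let μR := algebraMap ℂ (smoothFunctions V) μ
  have eμ : ∀ y : V, eval y μR = μ := fun y => rfl
  have eG : ∀ y : V, P.G.map (eval y) = H.complexGram y := fun y => (hP y).1
  have eA : ∀ y : V, P.A.map (eval y) = H.complexA y := fun y => (hP y).2.1
  have hG : ∀ y : V, (H.complexGram y)ᵀ = H.complexGram y := fun y => by
    rw [← eG]
    exact congrArg (fun M => M.map (eval y)) P.G_symm
  have hGA : ∀ y : V, (H.complexGram y * H.complexA y)ᵀ = H.complexGram y * H.complexA y :=
    fun y => by
      rw [← eG, ← eA, ← map_eval_mul]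
      exact congrArg (fun M => M.map (eval y)) P.G_mul_A_symm
  have hXR : P.A * X = μR • X := matrix_ext fun y => by
    rw [map_eval_mul, eA, (hX y).1, map_eval_smul, eμ]
  have hXX : Xᵀ * P.G * X = 1 := matrix_ext fun y => by
    rw [map_eval_mul, map_eval_mul, eG, map_eval_one]
    exact (hX y).2
  have eB : ∀ y : V, (P.shifted μR).map (eval y) = μ • 1 - H.complexA y := fun y => by
    rw [← eA, ParametrizedHypersurface.shifted, Matrix.map_sub _ (map_sub _), map_eval_smul,
      map_eval_one, eμ]
  have eQ : ∀ y : V, (P.focalForm μR X).map (eval y) = H.complexGram y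
      * ((μ • 1 - H.complexA y) * (μ • 1 - H.complexA y)
        + X.map (eval y) * ((X.map (eval y))ᵀ * H.complexGram y)) := fun y => by
    rw [ParametrizedHypersurface.focalForm, map_eval_mul, Matrix.map_add _ (map_add _),
      map_eval_mul, map_eval_mul, map_eval_mul, eG, eB]
    rfl
  have uQ : IsUnit (P.focalForm μR X).det := isUnit_det fun y => by
    obtain ⟨k, S, S', α, β, a, hβ, h, hS, hl⟩ := hμ y (hV y.2)
    rw [eQ]
    have := h.focal_det_ne_zero (hG y) (hGA y) (by rw [hl]; exact (hX y).1) (hX y).2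
      (det_map_ofReal_ne_zero (H.isTypeIV (hV y.2)).det_ne_zero)
    rwa [hl] at this
  let W := (P.focalForm μR X)⁻¹
  have hW : W * P.focalForm μR X = 1 := nonsing_inv_mul _ uQ
  have eW : ∀ y : V, W.map (eval y) * (H.complexGram y
      * ((μ • 1 - H.complexA y) * (μ • 1 - H.complexA y)
        + X.map (eval y) * ((X.map (eval y))ᵀ * H.complexGram y))) = 1 := fun y => by
    rw [← eQ, ← map_eval_mul, hW, map_eval_one]
  have etr : ∀ (M : Matrix (Fin n) (Fin n) (smoothFunctions V)) (y : V),
      eval y M.trace = (M.map (eval y)).trace := fun M y => by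
    simp [Matrix.trace]
  have htr : ∀ y : V, eval y (W * (P.G * P.shifted μR)).trace
      = ((H.complexA y₀).charpoly.roots.map fun z => 1 / (μ - z)).sum := by
    intro y
    obtain ⟨k, S, S', α, β, a, hβ, h, hS, hl⟩ := hμ y (hV y.2)
    have hM : (1 : Matrix (Fin n) (Fin n) ℂ) * S
        = S * diagonal fun _ : Fin 2 ⊕ Fin k => (1 : ℂ) := by
      rw [diagonal_one, Matrix.one_mul, Matrix.mul_one]
    have := h.trace_focal (hG y) (hGA y) (by rw [hl]; exact (hX y).1) (hX y).2
      (by rw [hl]; exact eW y) hM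
    rw [hl, Matrix.one_mul] at this
    rw [etr, map_eval_mul, map_eval_mul, eG, eB, this, H.roots_complexA hy₀ (hV y.2),
      h.roots_charpoly, Multiset.map_map]
    -- The sum over all roots includes μ itself, whose term is 1/0 = 0; this makes the trace an
    -- expression in the constant multiset of roots.
    refine Finset.sum_erase _ ?_
    simp [hl]
  have hmain := P.cartan_identity hXR (fun j => Derivation.map_algebraMap _ μ) hXX hW
    fun j => pderiv_eq_zero_of_eval_eq htr _
  have hmain' := congrArg (eval ⟨y₀, hyV⟩) hmain
  have hM : (((H.sign y₀ : ℂ) * μ) • H.complexA y₀ + (N.curvature : ℂ) • 1) * S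
      = S * diagonal fun j => ((H.sign y₀ : ℂ) * μ) * typeIVEigenvalues α β a j + N.curvature := by
    rw [Matrix.add_mul, Matrix.smul_mul, h.mul_eq, Matrix.smul_mul, Matrix.one_mul]
    ext i j
    simp only [Matrix.add_apply, Matrix.smul_apply, mul_diagonal, smul_eq_mul]
    ring
  have hlast := h.trace_focal (hG ⟨y₀, hyV⟩) (hGA ⟨y₀, hyV⟩)
    (by rw [hl]; exact (hX ⟨y₀, hyV⟩).1) (hX ⟨y₀, hyV⟩).2
    (by rw [hl]; exact eW ⟨y₀, hyV⟩) hM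
  rw [map_zero, etr, map_eval_mul, map_eval_mul, map_eval_mul, Matrix.map_add _ (map_add _),
    map_eval_smul, map_eval_smul, map_eval_one, map_mul, eμ, eG, eB, eA, (hP _).2.2.1,
    (hP _).2.2.2] at hmain'
  rw [hl, hmain'] at hlast
  refine typeIV_sum_ne_zero (α := α) a hβ (H.sign_mul_self hy₀) (hsign y₀ hy₀) ?_
  rw [← typeIVEigenvalues_inl_zero α β a, hl]
  exact hlast.symm

end LocalHypersurface

end

/-! ### The four space forms -/

theorem theoremA1 (n : ℕ) {M : Type*} [TopologicalSpace M]
    [ChartedSpace (EuclideanSpace ℝ (Fin n)) M] [IsManifold (𝓡 n) ∞ M] [ConnectedSpace M] :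
    (¬ ∃ f : Hypersurface SpaceForm.euclidean 1 n M,
      f.IsIsoparametric ∧ f.IsPetrovTypeIVIndexOne) ∧
    (¬ ∃ f : Hypersurface SpaceForm.euclidean 2 n M,
      f.IsIsoparametric ∧ f.IsPetrovTypeIVIndexOne) ∧
    (¬ ∃ f : Hypersurface SpaceForm.sphere 1 n M,
      f.IsIsoparametric ∧ f.IsPetrovTypeIVIndexOne) ∧
    (¬ ∃ f : Hypersurface SpaceForm.hyperbolic 2 n M,
      f.IsIsoparametric ∧ f.IsPetrovTypeIVIndexOne) := by
  have key : ∀ (N : SpaceForm) (s : ℕ), (∀ H : LocalHypersurface N s n, ∀ y ∈ H.U,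
      0 ≤ N.curvature * H.sign y) → ¬ ∃ f : Hypersurface N s n M,
        f.IsIsoparametric ∧ f.IsPetrovTypeIVIndexOne := by
    rintro N s hs ⟨f, hf, hf'⟩
    obtain ⟨x₀⟩ : Nonempty M := inferInstance
    obtain ⟨H, hH⟩ := f.exists_localHypersurface hf hf' x₀
    exact H.false_of_sign hH (hs H)
  refine ⟨key _ _ fun H y _ => ?_, key _ _ fun H y _ => ?_, key _ _ fun H y hy => ?_,
    key _ _ fun H y hy => ?_⟩
  · simp [SpaceForm.curvature]
  · simp [SpaceForm.curvature]
  · rw [H.sign_sphere hy]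
    simp [SpaceForm.curvature]
  · rw [H.sign_hyperbolic hy]
    simp [SpaceForm.curvature]
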